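/- **Setting.** Let $\mathcal H$ be a (real or complex) Hilbert space. A sequence $\mathcal G=(g_n)_{n\in\mathbb Z}$ in $\mathcal H$ is a *frame* if $a\|f\|^2\le\sum_n|\langle f,g_n\rangle|^2\le b\|f\|^2$ for all $f\in\mathcal H$, for some $0<a\le b<\infty$; its canonical dual is $\tilde{\mathcal G}=(\tilde g_n)_n$, $\tilde g_n=S^{-1}g_n$, where $Sf=\sum_n\langle f,g_n\rangle g_n$. For $s\ge 0$, $\mathcal A^1_s$ is the set of matrices $A=(a_{kl})_{k,l\in\mathbb Z}$ with $$\|A\|_{\mathcal A^1_s}=\max\Big\{\sup_k\sum_l|a_{kl}|(1+|k-l|)^s,\ \sup_l\sum_k|a_{kl}|(1+|k-l|)^s\Big\}<\infty,$$ and $\mathcal A^1=\mathcal A^1_0$. For sequences $\mathcal E,\mathcal F$ in $\mathcal H$ put $A(\mathcal E,\mathcal F)=(\langle e_n,f_x\rangle)_{n,x}$; for frames $\mathcal E,\mathcal F$ write $\mathcal E\sim_{\mathcal A^1_s}\mathcal F$ if $A(\mathcal E,\mathcal F)\in\mathcal A^1_s$. Given a frame $\mathcal G$ with $\mathcal G\sim_{\mathcal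 A^1_s}\mathcal G$ for some $s>0$, the spaces $\mathcal H^p=\mathcal H^p(\mathcal G,\tilde{\mathcal G})$, $1\le p\le\infty$, are defined with the norm $\|f\|_{\mathcal H^p}=\|(\langle f,\tilde g_n\rangle)_n\|_{\ell^p}$ as follows: for $1\le p\le 2$, $\mathcal H^p=\{f\in\mathcal H:(\langle f,\tilde g_n\rangle)_n\in\ell^p\}$; for $2<p<\infty$, $\mathcal H^p$ is the completion of the finite linear span of $\mathcal G$; and $\mathcal H^\infty=(\mathcal H^1)'$, the space of bounded conjugate-linear functionals on $\mathcal H^1$, where $f\in\mathcal H$ acts by $h\mapsto\langle f,h\rangle$ (the vectors $\tilde g_n$ lie in $\mathcal H^1$). A sequence $(x_n)_{n\in\mathbb Z}$ in $\mathcal H$ is a *frame atomic decomposition for $\mathcal H^p$ with bounds $A,B>0$* if all $x_n$ belong to $\mathcal H^p$ (for $p>2$: via the natural map $\mathcal H\to\mathcal H^p$) and there are $x_n'\in(\mathcal H^p)'$ such that $f\mapsto(x_n'(f))_n$ is bounded from $\mathcal H^p$ to $\ell^p$ and, for all $f\in\mathcal H^p$, $$A\|f\|_{\mathcal H^p}\le\|(x_n'(f))_n\|_{\ell^p}\le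 B\|f\|_{\mathcal H^p},\qquad f=\sum_n x_n'(f)\,x_n$$ with unconditional convergence, in norm if $p<\infty$ and in the weak-$*$ topology of $(\mathcal H^1)'$ if $p=\infty$. **Theorem.** Let $s>0$ and let $\mathcal G,\mathcal F$ be frames for $\mathcal H$ with $\mathcal G\sim_{\mathcal A^1_s}\mathcal G$, $\mathcal F\sim_{\mathcal A^1_s}\mathcal F$ and $\mathcal F\sim_{\mathcal A^1_s}\mathcal G$. Then $\mathcal F$ is a frame atomic decomposition for $\mathcal H^p$ for every $p\in[1,\infty]$, with some bounds. Let moreover $A_p,B_p>0$, $p\in[1,\infty]$, be such that $\mathcal F$ is a frame atomic decomposition for $\mathcal H^p$ with bounds $A_p,B_p$ for each $p$, and assume $B:=\sup_{p\in[1,\infty]}B_p<\infty$. Let $\mathcal E=(e_n)_{n\in\mathbb Z}$ be a sequence in $\mathcal H$ with $$\|A(\mathcal E-\mathcal F,\tilde{\mathcal G})\|_{\mathcal A^1}=\max\Big\{\sup_n\sum_x|\langle e_n-f_n,\tilde g_x\rangle|,\ \sup_x\sum_n|\langle e_n-f_n,\tilde g_x\rangle|\Big\}\le\varepsilon,\qquad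 0<\varepsilon<B^{-1}.$$ Then $\mathcal E$ is a frame for $\mathcal H$ with $\mathcal E\sim_{\mathcal A^1}\mathcal E$, $\mathcal E\sim_{\mathcal A^1}\mathcal F$, $\mathcal E\sim_{\mathcal A^1}\mathcal G$, and for every $p\in[1,\infty]$ the sequence $\mathcal E$ is a frame atomic decomposition for $\mathcal H^p$ with bounds $A_p(1+\varepsilon B_p)^{-1}$ and $B_p(1-\varepsilon B_p)^{-1}$. -/

import Mathlib

open scoped ENNReal
open Filter Topology

namespace FrameLoc

variable {𝕜 H : Type*} [RCLike 𝕜] [NormedAddCommGroup H] [InnerProductSpace 𝕜 H]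

/-- The Hilbert space pairing `⟨f, g⟩`, linear in `f` and conjugate-linear in `g`. -/
def pair (𝕜 : Type*) {H : Type*} [RCLike 𝕜] [NormedAddCommGroup H] [InnerProductSpace 𝕜 H]
    (f g : H) : 𝕜 := inner 𝕜 g f

/-- `g` is a frame: `A ‖f‖² ≤ ∑ₙ |⟨f, gₙ⟩|² ≤ B ‖f‖²` for all `f`, with `0 < A ≤ B < ∞`. -/
def IsFrame (𝕜 : Type*) {H : Type*} [RCLike 𝕜] [NormedAddCommGroup H] [InnerProductSpace 𝕜 H]
    (g : ℤ → H) : Prop :=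
  ∃ A B : ℝ, 0 < A ∧ A ≤ B ∧ ∀ f : H,
    Summable (fun n => ‖pair 𝕜 f (g n)‖ ^ 2) ∧
      A * ‖f‖ ^ 2 ≤ ∑' n, ‖pair 𝕜 f (g n)‖ ^ 2 ∧
      ∑' n, ‖pair 𝕜 f (g n)‖ ^ 2 ≤ B * ‖f‖ ^ 2

/-- The cross-Gramian `A(e, f)` with entries `⟨eₙ, fₓ⟩`. -/
def gram (𝕜 : Type*) {H : Type*} [RCLike 𝕜] [NormedAddCommGroup H] [InnerProductSpace 𝕜 H]
    (e f : ℤ → H) : Matrix ℤ ℤ 𝕜 :=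
  Matrix.of fun n x => pair 𝕜 (e n) (f x)

/-- The weighted Schur norm, with weight `(1 + |k - l|)^s`; it is `∞` exactly when the matrix does
not belong to the Schur algebra. For `s = 0` the weight is `1`. -/
noncomputable def schurNorm (s : ℝ) (a : Matrix ℤ ℤ 𝕜) : ℝ≥0∞ :=
  max (⨆ k : ℤ, ∑' l : ℤ, ‖a k l‖ₑ * ENNReal.ofReal ((1 + |(k : ℝ) - (l : ℝ)|) ^ s))
    (⨆ l : ℤ, ∑' k : ℤ, ‖a k l‖ₑ * ENNReal.ofReal ((1 + |(k : ℝ) - (l : ℝ)|) ^ s))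

/-- The frame `e` is localized with respect to the frame `f`, in the Schur algebra with
parameter `s`. -/
def Localized (𝕜 : Type*) {H : Type*} [RCLike 𝕜] [NormedAddCommGroup H] [InnerProductSpace 𝕜 H]
    (s : ℝ) (e f : ℤ → H) : Prop :=
  IsFrame 𝕜 e ∧ IsFrame 𝕜 f ∧ schurNorm s (gram 𝕜 e f) < ∞

/-- The scalar sequence space `ℓ^p(ℤ)`. -/
abbrev ell (𝕜 : Type*) [RCLike 𝕜] (p : ℝ≥0∞) := lp (fun _ : ℤ => 𝕜) p

theorem IsFrame.memℓp {g : ℤ → H} (hg : IsFrame 𝕜 g) (f : H) :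
    Memℓp (fun n => pair 𝕜 f (g n)) 2 := by
  obtain ⟨A, B, -, -, h⟩ := hg
  refine memℓp_gen ?_
  simpa using (h f).1

theorem IsFrame.norm_sq {g : ℤ → H} (hg : IsFrame 𝕜 g) (f : H) :
    ‖(⟨_, hg.memℓp f⟩ : ell 𝕜 2)‖ ^ 2 = ∑' n, ‖pair 𝕜 f (g n)‖ ^ 2 := by
  have := lp.norm_rpow_eq_tsum (p := 2) (by norm_num) (⟨_, hg.memℓp f⟩ : ell 𝕜 2)
  simpa using this

/-- The analysis operator `f ↦ (⟨f, gₙ⟩)ₙ` of a frame, as a bounded operator `H → ℓ²`. -/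
noncomputable def analysisOp (g : ℤ → H) (hg : IsFrame 𝕜 g) : H →L[𝕜] ell 𝕜 2 :=
  LinearMap.mkContinuousOfExistsBound
    { toFun := fun f => ⟨fun n => pair 𝕜 f (g n), hg.memℓp f⟩
      map_add' := fun f f' => by
        ext n
        simp only [pair, inner_add_right]
        rfl
      map_smul' := fun c f => by ext n; simp [pair, inner_smul_right] } (by
    obtain ⟨A, B, hA, hAB, h⟩ := id hg
    refine ⟨Real.sqrt B, fun f => ?_⟩
    refine abs_le_of_sq_le_sq' ?_ (by positivity) |>.2
    rw [mul_pow, Real.sq_sqrt (hA.le.trans hAB)]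
    exact (hg.norm_sq f).trans_le (h f).2.2)

variable [CompleteSpace H]

/-- The frame operator `S = C* C`. -/
noncomputable def frameOp (g : ℤ → H) (hg : IsFrame 𝕜 g) : H →L[𝕜] H :=
  (ContinuousLinearMap.adjoint (analysisOp g hg)) ∘L analysisOp g hg

theorem isUnit_frameOp (g : ℤ → H) (hg : IsFrame 𝕜 g) : IsUnit (frameOp g hg) := by
  obtain ⟨A, B, hA, hAB, h⟩ := id hg
  refine ContinuousLinearMap.isUnit_of_forall_le_norm_inner_map _ (c := ⟨A, hA.le⟩) hA
    fun f => ?_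
  have h1 : inner 𝕜 (frameOp g hg f) f = ((‖analysisOp g hg f‖ ^ 2 : ℝ) : 𝕜) := by
    simp only [frameOp, ContinuousLinearMap.comp_apply, ContinuousLinearMap.adjoint_inner_left]
    rw [inner_self_eq_norm_sq_to_K]
    push_cast
    rfl
  rw [h1, RCLike.norm_ofReal, abs_of_nonneg (by positivity), mul_comm]
  exact (h f).2.1.trans_eq (hg.norm_sq f).symm

theorem adjoint_analysisOp_single (g : ℤ → H) (hg : IsFrame 𝕜 g) (n : ℤ) (c : 𝕜) :
    ContinuousLinearMap.adjoint (analysisOp g hg) (lp.single 2 n c) = c • g n := by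
  refine ext_inner_right 𝕜 fun f => ?_
  rw [ContinuousLinearMap.adjoint_inner_left, lp.inner_single_left, inner_smul_left]
  change inner 𝕜 c (inner 𝕜 (g n) f) = _
  rw [RCLike.inner_apply, mul_comm]

/-- The canonical dual frame `S⁻¹ gₙ`. -/
noncomputable def dual (g : ℤ → H) (hg : IsFrame 𝕜 g) (n : ℤ) : H :=
  Ring.inverse (frameOp g hg) (g n)

theorem pair_dual (g : ℤ → H) (hg : IsFrame 𝕜 g) (f : H) (n : ℤ) :
    pair 𝕜 f (dual g hg n) =
      pair 𝕜 (ContinuousLinearMap.adjoint (Ring.inverse (frameOp g hg)) f) (g n) := by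
  simp [pair, dual, ContinuousLinearMap.adjoint_inner_right]

theorem dual_memℓp (g : ℤ → H) (hg : IsFrame 𝕜 g) (f : H) {p : ℝ≥0∞} (hp : 2 ≤ p) :
    Memℓp (fun n => pair 𝕜 f (dual g hg n)) p := by
  simp_rw [pair_dual]
  exact (hg.memℓp _).of_exponent_ge hp

/-- Reconstruction `f = ∑ₙ ⟨f, g̃ₙ⟩ gₙ`, valid for every `f` in `H`. -/
theorem hasSum_dual (g : ℤ → H) (hg : IsFrame 𝕜 g) (f : H) :
    HasSum (fun n => pair 𝕜 f (dual g hg n) • g n) f := by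
  have hsa : star (frameOp g hg) = frameOp g hg := by
    simp [ContinuousLinearMap.star_eq_adjoint, frameOp, ContinuousLinearMap.adjoint_comp]
  have hinv : ContinuousLinearMap.adjoint (Ring.inverse (frameOp g hg)) =
      Ring.inverse (frameOp g hg) := by
    rw [← ContinuousLinearMap.star_eq_adjoint, ← Ring.inverse_star, hsa]
  simp_rw [pair_dual, hinv]
  set f' := Ring.inverse (frameOp g hg) f with hf'
  have hf : frameOp g hg f' = f := by
    have := Ring.mul_inverse_cancel _ (isUnit_frameOp g hg)
    exact congrArg (fun T : H →L[𝕜] H => T f) this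
  have h := (lp.hasSum_single (p := 2) (by norm_num) (analysisOp g hg f')).mapL
    (ContinuousLinearMap.adjoint (analysisOp g hg))
  simp only [adjoint_analysisOp_single] at h
  change HasSum _ (frameOp g hg f') at h
  rw [hf] at h
  exact h

theorem eq_zero_of_dual (g : ℤ → H) (hg : IsFrame 𝕜 g) (f : H)
    (h : ∀ n, pair 𝕜 f (dual g hg n) = 0) : f = 0 := by
  have := hasSum_dual g hg f
  simp only [h, zero_smul] at this
  exact this.unique hasSum_zero

variable (g : ℤ → H) (hg : IsFrame 𝕜 g)

/-- The subspace `{f ∈ H : (⟨f, g̃ₙ⟩)ₙ ∈ ℓ^p}`. The expansion `f = ∑ₙ ⟨f, g̃ₙ⟩ gₙ` holds on all of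
`H` (`hasSum_dual`), so it need not be required; for `2 ≤ p` the subspace is all of `H`
(`coeffSubspace_eq_top`). -/
def coeffSubspace (p : ℝ≥0∞) : Submodule 𝕜 H where
  carrier := {f | Memℓp (fun n => pair 𝕜 f (dual g hg n)) p}
  zero_mem' := by
    have : (fun n => pair 𝕜 (0 : H) (dual g hg n)) = 0 := by ext n; simp [pair]
    simpa only [Set.mem_ofPred_eq, this] using zero_memℓp
  add_mem' := fun {a b} ha hb => by
    have : (fun n => pair 𝕜 (a + b) (dual g hg n)) =
        (fun n => pair 𝕜 a (dual g hg n)) + fun n => pair 𝕜 b (dual g hg n) := by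
      ext n; simp [pair, inner_add_right]
    simpa only [Set.mem_ofPred_eq, this] using ha.add hb
  smul_mem' := fun c a ha => by
    have : (fun n => pair 𝕜 (c • a) (dual g hg n)) =
        c • fun n => pair 𝕜 a (dual g hg n) := by
      ext n; simp [pair, inner_smul_right]
    simpa only [Set.mem_ofPred_eq, this] using ha.const_smul c

theorem coeffSubspace_eq_top {p : ℝ≥0∞} (hp : 2 ≤ p) : coeffSubspace g hg p = ⊤ :=
  eq_top_iff.2 fun f _ => dual_memℓp g hg f hp

/-- `coeffSubspace g hg p` as a type, to be normed by `‖f‖ = ‖(⟨f, g̃ₙ⟩)ₙ‖_{ℓ^p}` instead of the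
norm of `H`. For `1 ≤ p ≤ 2` this is the space `H^p`. -/
def Hp (p : ℝ≥0∞) : Type _ := coeffSubspace g hg p

namespace Hp

variable {g hg} {p : ℝ≥0∞}

instance : AddCommGroup (Hp g hg p) := inferInstanceAs (AddCommGroup (coeffSubspace g hg p))

instance : Module 𝕜 (Hp g hg p) := inferInstanceAs (Module 𝕜 (coeffSubspace g hg p))

/-- The inclusion into `H`. -/
def toH : Hp g hg p →ₗ[𝕜] H := (coeffSubspace g hg p).subtype

/-- The coefficient map `f ↦ (⟨f, g̃ₙ⟩)ₙ`. -/
noncomputable def coeff : Hp g hg p →ₗ[𝕜] ell 𝕜 p where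
  toFun := fun f => ⟨fun n => pair 𝕜 (toH f) (dual g hg n), f.2⟩
  map_add' := fun f f' => by
      ext n
      simp only [pair, map_add, inner_add_right]
      rfl
  map_smul' := fun c f => by ext n; simp [pair, inner_smul_right]

theorem coeff_injective : Function.Injective (coeff : Hp g hg p →ₗ[𝕜] ell 𝕜 p) := by
  refine (injective_iff_map_eq_zero _).2 fun f hf => ?_
  refine Subtype.ext (eq_zero_of_dual g hg f.1 fun n => ?_)
  exact congrFun (congrArg Subtype.val hf) n

noncomputable instance [Fact (1 ≤ p)] : NormedAddCommGroup (Hp g hg p) :=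
  NormedAddCommGroup.induced _ _ (coeff : Hp g hg p →ₗ[𝕜] ell 𝕜 p) coeff_injective

noncomputable instance [Fact (1 ≤ p)] : NormedSpace 𝕜 (Hp g hg p) :=
  NormedSpace.induced 𝕜 _ _ (coeff : Hp g hg p →ₗ[𝕜] ell 𝕜 p)

theorem norm_def [Fact (1 ≤ p)] (f : Hp g hg p) : ‖f‖ = ‖coeff f‖ := rfl

end Hp

/-- For `2 ≤ p` this is the space `H₀` of all finite linear combinations of the `gₙ`, with the
norm `‖f‖ = ‖(⟨f, g̃ₙ⟩)ₙ‖_{ℓ^p}`. -/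
def H0 (p : ℝ≥0∞) : Submodule 𝕜 (Hp g hg p) :=
  (Submodule.span 𝕜 (Set.range g)).comap Hp.toH

/-- For `2 < p < ∞`, the space `H^p`: the completion of `H₀` in the norm
`‖f‖ = ‖(⟨f, g̃ₙ⟩)ₙ‖_{ℓ^p}`. -/
abbrev HpCompl (p : ℝ≥0∞) [Fact (1 ≤ p)] : Type _ := UniformSpace.Completion (H0 g hg p)

/-- The space `H^∞ = (H¹)'`. It consists of the bounded conjugate-linear functionals on `H¹`, so
that `H` embeds linearly through `f ↦ (h ↦ ⟨f, h⟩)`. -/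
abbrev HInf : Type _ := Hp g hg 1 →SL[starRingEnd 𝕜] 𝕜

/-- The norm `‖φ‖ = ‖(⟨φ, g̃ₙ⟩)ₙ‖_{ℓ^∞}` on `H^∞`, where `⟨φ, g̃ₙ⟩ = φ (g̃ₙ)`. For
a frame `g` that is intrinsically localized with parameter `s > 0`, every `g̃ₙ` lies in `H¹`. -/
noncomputable def HInf.enorm (φ : HInf g hg) : ℝ≥0∞ :=
  ⨆ (n : ℤ) (h : dual g hg n ∈ coeffSubspace g hg 1), ‖φ (⟨dual g hg n, h⟩ : Hp g hg 1)‖ₑ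

/-- The sequence `x` in the Banach space `X` is a frame atomic decomposition of `X` with sequence
space `ℓ^p` and bounds `A`, `B`: there are coefficient functionals `xdₙ ∈ X'` whose coefficient
operator `C f = (⟨f, xdₙ⟩)ₙ` maps `X` boundedly to `ℓ^p`, `A ‖f‖ ≤ ‖C f‖ ≤ B ‖f‖`, and
`f = ∑ₙ ⟨f, xdₙ⟩ xₙ` with unconditional convergence in norm. -/
def IsFrameAtomicDecomposition (p : ℝ≥0∞) [Fact (1 ≤ p)] {X : Type*} [NormedAddCommGroup X]
    (𝕜 : Type*) [RCLike 𝕜] [NormedSpace 𝕜 X] (x : ℤ → X) (A B : ℝ) : Prop :=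
  0 < A ∧ 0 < B ∧ ∃ (xd : ℤ → StrongDual 𝕜 X) (C : X →L[𝕜] ell 𝕜 p), ∀ f : X,
    (∀ n, C f n = xd n f) ∧
    A * ‖f‖ ≤ ‖C f‖ ∧ ‖C f‖ ≤ B * ‖f‖ ∧
    HasSum (fun n => xd n f • x n) f

/-- The same notion for the dual space `H^∞ = (H¹)'`, where the series converges unconditionally
in the weak-* topology, that is, on every `h ∈ H¹`. -/
def IsFrameAtomicDecompositionInf (x : ℤ → HInf g hg) (A B : ℝ) : Prop :=
  0 < A ∧ 0 < B ∧ ∃ (xd : ℤ → StrongDual 𝕜 (HInf g hg)) (C : HInf g hg →L[𝕜] ell 𝕜 ∞),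
    ∀ φ : HInf g hg,
    (∀ n, C φ n = xd n φ) ∧
    ENNReal.ofReal A * HInf.enorm g hg φ ≤ ‖C φ‖ₑ ∧
    ‖C φ‖ₑ ≤ ENNReal.ofReal B * HInf.enorm g hg φ ∧
    ∀ h : Hp g hg 1, HasSum (fun n => xd n φ * x n h) (φ h)

/-- The element `x` of the completion of `H₀` is the image of `f ∈ H` under the continuous extension
to `H` of the inclusion of `H₀`. -/
def Represents (p : ℝ≥0∞) [Fact (1 ≤ p)] (f : H) (x : HpCompl g hg p) : Prop :=
  ∃ u : ℕ → H0 g hg p, Tendsto (fun k => Hp.toH (u k : Hp g hg p)) atTop (𝓝 f) ∧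
    Tendsto (fun k => (u k : HpCompl g hg p)) atTop (𝓝 x)

/-- The system `e` of vectors of `H` lies in the space `H^p` built from `g` and its canonical dual,
and is a frame atomic decomposition for it with bounds `A`, `B`, for `1 ≤ p ≤ ∞`. -/
def IsHpFrame (p : ℝ≥0∞) [Fact (1 ≤ p)] (e : ℤ → H) (A B : ℝ) : Prop :=
  (p ≤ 2 → ∃ x : ℤ → Hp g hg p,
    (∀ n, Hp.toH (x n) = e n) ∧ IsFrameAtomicDecomposition p 𝕜 x A B) ∧
  (2 < p → p ≠ ∞ → ∃ x : ℤ → HpCompl g hg p,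
    (∀ n, Represents g hg p (e n) (x n)) ∧ IsFrameAtomicDecomposition p 𝕜 x A B) ∧
  (p = ∞ → ∃ x : ℤ → HInf g hg,
    (∀ n h, x n h = pair 𝕜 (e n) (Hp.toH h)) ∧ IsFrameAtomicDecompositionInf g hg x A B)

end FrameLoc

/-!
All coefficients are taken with respect to `G` and its canonical dual, and all bounds come from
matrices in the Schur algebra acting on `ℓ^p`, `1 ≤ p ≤ ∞` (Schur's test, `norm_act_le`).

The analytic core is that the canonical dual of an intrinsically localized frame is again
localized (`schurNorm_gram_dual_lt_top`). With `C` the analysis operator and `S = C* C`, the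
Gramian of the dual is `C S⁻² C* = c² ∑ₙ (n + 1) Tⁿ C C*` for `T = 1 - c C C*` and a
small `c > 0`. The operator `T` is only a contraction, but `Tⁿ C C* = C (1 - c S)ⁿ C*` decays exponentially
in operator norm. In the weighted Schur norm the powers of a contraction grow subexponentially
(`exists_rowNorm_pow_le`): for `s ≤ 1` the weight is subadditive, so squaring costs one weighted
and one unweighted norm, and the unweighted norm interpolates between the operator norm and the
weighted norm (`rowNorm_zero_le_split`). The same interpolation turns the two rates into
exponential decay in the unweighted Schur norm (`exists_rowNorm_zero_le_geometric`), so the series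
converges in the Schur algebra. The weight is spent here: the dual is localized without weight,
which is all that the rest uses.

Each space `H^p` comes with a coefficient map `J` into `ℓ^p` and a synthesis operator `D` from
`ℓ^p` with `D J = 1` and `J D` equal to the matrix of `G` against its dual. For the localized
frame `F` the expansion in `F` and its dual is then a product of Schur matrices between `D` and
`J` (`exists_decomposes_of_localized`). For the perturbation, let `C` be the given coefficient
operator of `F` and `R` the synthesis operator of `E - F`. The Schur norm of the matrix of `E - F`
bounds `J R` by `ε`, so `1 + C R` is invertible on `ℓ^p` by a Neumann series, hence so is
`1 + R C`, which sends `f` to its expansion with the atoms of `F` replaced by those of `E`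
(`Decomposes.perturb`). This argument needs neither the completeness of `H^p` nor an isometric
`J`, and it covers the weak-* convergence in `H^∞` along with the norm convergence for `p < ∞`.
The frame property of `E` is read off from the case `p = 2` (`isFrame_of_isHpFrame_two`).
-/

namespace FrameLoc

/-! ### Weighted row sums of matrices -/

section RowNorm

variable {𝕜 : Type*} [RCLike 𝕜]

/-- The polynomial weight `(1 + |k - l|)^s`. -/
noncomputable def weight (s : ℝ) (k l : ℤ) : ℝ≥0∞ :=
  ENNReal.ofReal ((1 + |(k : ℝ) - (l : ℝ)|) ^ s)

theorem weight_comm (s : ℝ) (k l : ℤ) : weight s k l = weight s l k := by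
  rw [weight, weight, abs_sub_comm]

@[simp] theorem weight_zero (k l : ℤ) : weight 0 k l = 1 := by simp [weight]

@[simp] theorem weight_self (s : ℝ) (k : ℤ) : weight s k k = 1 := by simp [weight]

theorem weight_mono {s t : ℝ} (h : s ≤ t) (k l : ℤ) : weight s k l ≤ weight t k l :=
  ENNReal.ofReal_le_ofReal
    (Real.rpow_le_rpow_of_exponent_le (by linarith [abs_nonneg ((k : ℝ) - l)]) h)

theorem weight_le_mul {s : ℝ} (hs : 0 ≤ s) (k j l : ℤ) :
    weight s k l ≤ weight s k j * weight s j l := by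
  have h1 := abs_nonneg ((k : ℝ) - j)
  have h2 := abs_nonneg ((j : ℝ) - l)
  rw [weight, weight, weight, ← ENNReal.ofReal_mul (by positivity),
    ← Real.mul_rpow (by positivity) (by positivity)]
  refine ENNReal.ofReal_le_ofReal (Real.rpow_le_rpow (by positivity) ?_ hs)
  nlinarith [abs_sub_le (k : ℝ) j l]

theorem weight_le_add {s : ℝ} (hs : 0 ≤ s) (hs1 : s ≤ 1) (k j l : ℤ) :
    weight s k l ≤ weight s k j + weight s j l := by
  have h1 := abs_nonneg ((k : ℝ) - j)
  have h2 := abs_nonneg ((j : ℝ) - l)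
  rw [weight, weight, weight, ← ENNReal.ofReal_add (by positivity) (by positivity)]
  refine ENNReal.ofReal_le_ofReal ?_
  calc (1 + |(k : ℝ) - l|) ^ s
      ≤ ((1 + |(k : ℝ) - j|) + (1 + |(j : ℝ) - l|)) ^ s :=
        Real.rpow_le_rpow (by positivity) (by linarith [abs_sub_le (k : ℝ) j l]) hs
    _ ≤ _ := Real.rpow_add_le_add_rpow (by positivity) (by positivity) hs hs1

/-- The supremum of the weighted `ℓ¹` norms of the rows of a matrix. -/
noncomputable def rowNorm (s : ℝ) (a : Matrix ℤ ℤ 𝕜) : ℝ≥0∞ :=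
  ⨆ k : ℤ, ∑' l : ℤ, ‖a k l‖ₑ * weight s k l

theorem row_le_rowNorm (s : ℝ) (a : Matrix ℤ ℤ 𝕜) (k : ℤ) :
    ∑' l : ℤ, ‖a k l‖ₑ * weight s k l ≤ rowNorm s a :=
  le_iSup (fun k : ℤ => ∑' l : ℤ, ‖a k l‖ₑ * weight s k l) k

theorem row_le_rowNorm_zero (a : Matrix ℤ ℤ 𝕜) (k : ℤ) :
    ∑' l : ℤ, ‖a k l‖ₑ ≤ rowNorm 0 a := by
  simpa using row_le_rowNorm 0 a k

theorem schurNorm_eq (s : ℝ) (a : Matrix ℤ ℤ 𝕜) :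
    schurNorm s a = max (rowNorm s a) (rowNorm s a.transpose) := by
  simp only [schurNorm, rowNorm, Matrix.transpose_apply]
  congr 1
  refine iSup_congr fun l => tsum_congr fun k => ?_
  rw [weight_comm]
  rfl

theorem rowNorm_mono_exponent {s t : ℝ} (h : s ≤ t) (a : Matrix ℤ ℤ 𝕜) :
    rowNorm s a ≤ rowNorm t a :=
  iSup_mono fun k => ENNReal.tsum_le_tsum fun l => by gcongr; exact weight_mono h k l

theorem schurNorm_mono_exponent {s t : ℝ} (h : s ≤ t) (a : Matrix ℤ ℤ 𝕜) :
    schurNorm s a ≤ schurNorm t a := by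
  rw [schurNorm_eq, schurNorm_eq]
  exact max_le_max (rowNorm_mono_exponent h _) (rowNorm_mono_exponent h _)

theorem tsum_tsum_mul_le (a : ℤ → ℝ≥0∞) (b : ℤ → ℤ → ℝ≥0∞) {B : ℝ≥0∞}
    (hb : ∀ j, ∑' l, b j l ≤ B) : ∑' l, ∑' j, a j * b j l ≤ (∑' j, a j) * B := by
  rw [ENNReal.tsum_comm, ← ENNReal.tsum_mul_right]
  refine ENNReal.tsum_le_tsum fun j => ?_
  rw [ENNReal.tsum_mul_left]
  gcongr
  exact hb j

/-- The weighted row norm is submultiplicative, for every matrix dominated by the product of the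
absolute values. -/
theorem rowNorm_le_mul {s : ℝ} (hs : 0 ≤ s) {a b c : Matrix ℤ ℤ 𝕜}
    (h : ∀ k l, ‖c k l‖ₑ ≤ ∑' j, ‖a k j‖ₑ * ‖b j l‖ₑ) :
    rowNorm s c ≤ rowNorm s a * rowNorm s b := by
  refine iSup_le fun k => ?_
  calc ∑' l, ‖c k l‖ₑ * weight s k l
      ≤ ∑' l, ∑' j, (‖a k j‖ₑ * weight s k j) * (‖b j l‖ₑ * weight s j l) := by
        refine ENNReal.tsum_le_tsum fun l => ?_
        calc _ ≤ (∑' j, ‖a k j‖ₑ * ‖b j l‖ₑ) * weight s k l := by gcongr; exact h k l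
          _ ≤ _ := by
            rw [← ENNReal.tsum_mul_right]
            refine ENNReal.tsum_le_tsum fun j => ?_
            calc _ ≤ ‖a k j‖ₑ * ‖b j l‖ₑ * (weight s k j * weight s j l) := by
                  gcongr; exact weight_le_mul hs k j l
              _ = _ := by ring
    _ ≤ _ := (tsum_tsum_mul_le _ _ (row_le_rowNorm s b)).trans <| by
        gcongr; exact row_le_rowNorm s a k

/-- For `s ≤ 1` the weight is subadditive, and the weighted row norm satisfies a Leibniz rule with
respect to the unweighted one. -/
theorem rowNorm_le_add {s : ℝ} (hs : 0 ≤ s) (hs1 : s ≤ 1) {a b c : Matrix ℤ ℤ 𝕜}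
    (h : ∀ k l, ‖c k l‖ₑ ≤ ∑' j, ‖a k j‖ₑ * ‖b j l‖ₑ) :
    rowNorm s c ≤ rowNorm s a * rowNorm 0 b + rowNorm 0 a * rowNorm s b := by
  refine iSup_le fun k => ?_
  calc ∑' l, ‖c k l‖ₑ * weight s k l
      ≤ ∑' l, ((∑' j, (‖a k j‖ₑ * weight s k j) * ‖b j l‖ₑ) +
          ∑' j, ‖a k j‖ₑ * (‖b j l‖ₑ * weight s j l)) := by
        refine ENNReal.tsum_le_tsum fun l => ?_
        calc _ ≤ (∑' j, ‖a k j‖ₑ * ‖b j l‖ₑ) * weight s k l := by gcongr; exact h k l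
          _ ≤ _ := by
            rw [← ENNReal.tsum_mul_right, ← ENNReal.tsum_add]
            refine ENNReal.tsum_le_tsum fun j => ?_
            calc _ ≤ ‖a k j‖ₑ * ‖b j l‖ₑ * (weight s k j + weight s j l) := by
                  gcongr; exact weight_le_add hs hs1 k j l
              _ = _ := by ring
    _ ≤ _ := by
        rw [ENNReal.tsum_add]
        gcongr
        · exact (tsum_tsum_mul_le _ _ (row_le_rowNorm_zero b)).trans <| by
            gcongr; exact row_le_rowNorm s a k
        · exact (tsum_tsum_mul_le _ _ (row_le_rowNorm s b)).trans <| by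
            gcongr; exact row_le_rowNorm_zero a k

theorem enorm_le_tsum_mul {a b : ℤ → 𝕜} {c : 𝕜} (h : HasSum (fun j => a j * b j) c) :
    ‖c‖ₑ ≤ ∑' j, ‖a j‖ₑ * ‖b j‖ₑ := by
  rw [← h.tsum_eq]
  refine enorm_tsum_le_tsum_enorm.trans_eq (tsum_congr fun j => enorm_mul _ _)

theorem schurNorm_zero_le_mul {a b c : Matrix ℤ ℤ 𝕜}
    (h : ∀ k l, HasSum (fun j => a k j * b j l) (c k l)) :
    schurNorm 0 c ≤ schurNorm 0 a * schurNorm 0 b := by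
  rw [schurNorm_eq, schurNorm_eq, schurNorm_eq]
  refine max_le ?_ ?_
  · exact (rowNorm_le_mul le_rfl fun k l => enorm_le_tsum_mul (h k l)).trans
      (mul_le_mul' (le_max_left _ _) (le_max_left _ _))
  · rw [mul_comm]
    refine (rowNorm_le_mul le_rfl (a := b.transpose) (b := a.transpose) fun k l => ?_).trans
      (mul_le_mul' (le_max_right _ _) (le_max_right _ _))
    refine enorm_le_tsum_mul ?_
    simpa only [Matrix.transpose_apply, mul_comm] using h l k

theorem rowNorm_add_le (s : ℝ) (a b : Matrix ℤ ℤ 𝕜) :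
    rowNorm s (a + b) ≤ rowNorm s a + rowNorm s b := by
  refine iSup_le fun k => ?_
  refine le_trans ?_ (add_le_add (row_le_rowNorm s a k) (row_le_rowNorm s b k))
  rw [← ENNReal.tsum_add]
  refine ENNReal.tsum_le_tsum fun l => ?_
  rw [← add_mul]
  gcongr
  exact enorm_add_le _ _

theorem schurNorm_add_le (s : ℝ) (a b : Matrix ℤ ℤ 𝕜) :
    schurNorm s (a + b) ≤ schurNorm s a + schurNorm s b := by
  simp only [schurNorm_eq, Matrix.transpose_add]
  exact max_le
    ((rowNorm_add_le _ _ _).trans (add_le_add (le_max_left _ _) (le_max_left _ _)))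
    ((rowNorm_add_le _ _ _).trans (add_le_add (le_max_right _ _) (le_max_right _ _)))

theorem rowNorm_smul (s : ℝ) (c : 𝕜) (a : Matrix ℤ ℤ 𝕜) :
    rowNorm s (c • a) = ‖c‖ₑ * rowNorm s a := by
  simp only [rowNorm, ENNReal.mul_iSup, Matrix.smul_apply, smul_eq_mul, enorm_mul, mul_assoc,
    ENNReal.tsum_mul_left]

theorem schurNorm_eq_of_norm_swap (s : ℝ) {a b : Matrix ℤ ℤ 𝕜} (h : ∀ k l, ‖a k l‖ = ‖b l k‖) :
    schurNorm s a = schurNorm s b := by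
  have h1 : ∀ t, rowNorm t a = rowNorm t b.transpose := fun t => by
    simp only [rowNorm, Matrix.transpose_apply, enorm_eq_iff_norm_eq.2 (h _ _)]
  have h2 : ∀ t, rowNorm t a.transpose = rowNorm t b := fun t => by
    simp only [rowNorm, Matrix.transpose_apply, enorm_eq_iff_norm_eq.2 (h _ _)]
  rw [schurNorm_eq, schurNorm_eq, h1, h2, max_comm]

theorem schurNorm_eq_rowNorm_of_norm_symm (s : ℝ) {a : Matrix ℤ ℤ 𝕜}
    (h : ∀ k l, ‖a k l‖ = ‖a l k‖) : schurNorm s a = rowNorm s a := by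
  have h1 : rowNorm s a.transpose = rowNorm s a := by
    simp only [rowNorm, Matrix.transpose_apply]
    exact iSup_congr fun k => tsum_congr fun l => by rw [enorm_eq_iff_norm_eq.2 (h l k)]
  rw [schurNorm_eq, h1, max_self]

end RowNorm

/-! ### Matrix entries of operators on `ℓ²` -/

section Entries

variable {𝕜 : Type*} [RCLike 𝕜]

theorem hasSum_map_single {p : ℝ≥0∞} [Fact (1 ≤ p)] (hp : p ≠ ∞) {X : Type*}
    [NormedAddCommGroup X] [NormedSpace 𝕜 X] (T : ell 𝕜 p →L[𝕜] X) (c : ell 𝕜 p) :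
    HasSum (fun n => c n • T (lp.single p n 1)) (T c) := by
  have h := (lp.hasSum_single hp c).mapL T
  refine h.congr_fun fun n => ?_
  rw [← map_smul, ← lp.single_smul, smul_eq_mul, mul_one]

/-- The matrix of an operator on `ℓ²(ℤ)` with respect to the standard basis. -/
noncomputable def entries (T : ell 𝕜 2 →L[𝕜] ell 𝕜 2) : Matrix ℤ ℤ 𝕜 :=
  Matrix.of fun k l => T (lp.single 2 l 1) k

theorem entries_add (T S : ell 𝕜 2 →L[𝕜] ell 𝕜 2) : entries (T + S) = entries T + entries S := rfl

theorem entries_smul (c : 𝕜) (T : ell 𝕜 2 →L[𝕜] ell 𝕜 2) : entries (c • T) = c • entries T := rfl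

theorem hasSum_entries_mul (T S : ell 𝕜 2 →L[𝕜] ell 𝕜 2) (k l : ℤ) :
    HasSum (fun j => entries T k j * entries S j l) (entries (T * S) k l) := by
  have h := hasSum_map_single (by simp) ((lp.evalCLM 𝕜 (fun _ : ℤ => 𝕜) 2 k) ∘L T)
    (S (lp.single 2 l 1))
  refine h.congr_fun fun j => ?_
  rw [smul_eq_mul, mul_comm]
  rfl

theorem rowNorm_entries_mul {s : ℝ} (hs : 0 ≤ s) (T S : ell 𝕜 2 →L[𝕜] ell 𝕜 2) :
    rowNorm s (entries (T * S)) ≤ rowNorm s (entries T) * rowNorm s (entries S) :=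
  rowNorm_le_mul hs fun k l => enorm_le_tsum_mul (hasSum_entries_mul T S k l)

theorem rowNorm_entries_mul_self {s : ℝ} (hs : 0 ≤ s) (hs1 : s ≤ 1)
    (T : ell 𝕜 2 →L[𝕜] ell 𝕜 2) :
    rowNorm s (entries (T * T)) ≤ 2 * rowNorm 0 (entries T) * rowNorm s (entries T) := by
  refine (rowNorm_le_add hs hs1 fun k l =>
    enorm_le_tsum_mul (hasSum_entries_mul T T k l)).trans_eq ?_
  ring

theorem rowNorm_entries_one_le (s : ℝ) :
    rowNorm s (entries (1 : ell 𝕜 2 →L[𝕜] ell 𝕜 2)) ≤ 1 := by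
  refine iSup_le fun k => ?_
  rw [tsum_eq_single k fun l hl => ?_]
  · simp [entries]
  · simp [entries, Pi.single_eq_of_ne hl.symm]

theorem rowNorm_entries_pow {s : ℝ} (hs : 0 ≤ s) (T : ell 𝕜 2 →L[𝕜] ell 𝕜 2) (n : ℕ) :
    rowNorm s (entries (T ^ n)) ≤ rowNorm s (entries T) ^ n := by
  induction n with
  | zero => simpa using rowNorm_entries_one_le s
  | succ n ih =>
    rw [pow_succ, pow_succ]
    exact (rowNorm_entries_mul hs _ _).trans (by gcongr)

theorem sum_sq_entries_le (T : ell 𝕜 2 →L[𝕜] ell 𝕜 2) (k : ℤ) (F : Finset ℤ) :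
    ∑ l ∈ F, ‖entries T k l‖ ^ 2 ≤ ‖T‖ ^ 2 := by
  have h : ∀ l, ‖entries T k l‖ = ‖ContinuousLinearMap.adjoint T (lp.single 2 k 1) l‖ := by
    intro l
    have h1 : entries T k l = inner 𝕜 (lp.single 2 k (1 : 𝕜)) (T (lp.single 2 l 1)) := by
      rw [lp.inner_single_left]; simp [entries]
    rw [h1, ← ContinuousLinearMap.adjoint_inner_left, lp.inner_single_right]
    simp
  calc ∑ l ∈ F, ‖entries T k l‖ ^ 2
      ≤ ‖ContinuousLinearMap.adjoint T (lp.single 2 k 1)‖ ^ 2 := by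
        have := lp.sum_rpow_le_norm_rpow (p := 2) (by norm_num)
          (ContinuousLinearMap.adjoint T (lp.single 2 k 1)) F
        simpa [h] using this
    _ ≤ ‖T‖ ^ 2 := by
        gcongr
        refine (ContinuousLinearMap.le_opNorm _ _).trans ?_
        rw [lp.norm_single (by norm_num), LinearIsometryEquiv.norm_map]
        simp

/-- Splitting each row at distance `R` from the diagonal: near the diagonal the Cauchy–Schwarz
inequality bounds it by the operator norm, far from it the weight is at least `R ^ s`. -/
theorem rowNorm_zero_le_split {s R : ℝ} (hs : 0 ≤ s) (hR : 1 ≤ R)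
    (T : ell 𝕜 2 →L[𝕜] ell 𝕜 2) :
    rowNorm 0 (entries T) ≤ ENNReal.ofReal (2 * R ^ (1 / 2 : ℝ) * ‖T‖) +
      ENNReal.ofReal (R ^ (-s)) * rowNorm s (entries T) := by
  refine iSup_le fun k => ?_
  set F : Finset ℤ := Finset.Icc (k - ⌊R⌋) (k + ⌊R⌋) with hF
  have hR0 : 0 ≤ ⌊R⌋ := Int.floor_nonneg.2 (by linarith)
  have hcard : (F.card : ℝ) ≤ 4 * R := by
    have h1 : (F.card : ℤ) = 2 * ⌊R⌋ + 1 := by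
      rw [hF, Int.card_Icc, Int.toNat_of_nonneg (by linarith)]; ring
    have h2 : (F.card : ℝ) = 2 * ⌊R⌋ + 1 := by exact_mod_cast h1
    linarith [Int.floor_le R]
  have hpt : ∀ l, ‖entries T k l‖ₑ * weight 0 k l ≤ (if l ∈ F then ‖entries T k l‖ₑ else 0) +
      ENNReal.ofReal (R ^ (-s)) * (‖entries T k l‖ₑ * weight s k l) := by
    intro l
    rw [weight_zero, mul_one]
    split_ifs with h
    · exact le_self_add
    · have hl : R ≤ 1 + |(k : ℝ) - l| := by
        have h3 : ⌊R⌋ < |k - l| := by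
          by_contra! hcon
          rw [abs_le] at hcon
          exact h (Finset.mem_Icc.2 ⟨by linarith, by linarith⟩)
        have h4 : (⌊R⌋ : ℝ) < |(k : ℝ) - l| := by exact_mod_cast h3
        linarith [Int.lt_floor_add_one R]
      have hone : 1 ≤ ENNReal.ofReal (R ^ (-s)) * weight s k l := by
        rw [weight, ← ENNReal.ofReal_mul (by positivity), ENNReal.one_le_ofReal,
          Real.rpow_neg (by linarith), ← div_eq_inv_mul, one_le_div (by positivity)]
        exact Real.rpow_le_rpow (by linarith) hl hs
      calc ‖entries T k l‖ₑ = ‖entries T k l‖ₑ * 1 := (mul_one _).symm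
        _ ≤ ‖entries T k l‖ₑ * (ENNReal.ofReal (R ^ (-s)) * weight s k l) := by gcongr
        _ = _ := by rw [zero_add]; ring
  refine (ENNReal.tsum_le_tsum hpt).trans ?_
  rw [ENNReal.tsum_add, ENNReal.tsum_mul_left]
  refine add_le_add ?_ (by gcongr; exact row_le_rowNorm s (entries T) k)
  rw [tsum_eq_sum (s := F) (fun l hl => by simp [hl]), Finset.sum_congr rfl
    (g := fun l => ENNReal.ofReal ‖entries T k l‖) (fun l hl => by simp [hl]),
    ← ENNReal.ofReal_sum_of_nonneg (fun _ _ => norm_nonneg _)]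
  refine ENNReal.ofReal_le_ofReal ?_
  refine abs_le_of_sq_le_sq' ?_ (by positivity) |>.2
  calc (∑ l ∈ F, ‖entries T k l‖) ^ 2 ≤ F.card * ∑ l ∈ F, ‖entries T k l‖ ^ 2 :=
        sq_sum_le_card_mul_sum_sq
    _ ≤ 4 * R * ‖T‖ ^ 2 := by
        gcongr
        exact sum_sq_entries_le T k F
    _ = _ := by
        rw [mul_pow, mul_pow, ← Real.sqrt_eq_rpow, Real.sq_sqrt (by linarith)]
        ring

/-- Interpolation between the operator norm and the weighted row norm. -/
theorem rowNorm_zero_le_rpow {s x : ℝ} (hs : 0 < s) (hx : 1 ≤ x) {T : ell 𝕜 2 →L[𝕜] ell 𝕜 2}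
    (hT : ‖T‖ ≤ 1) (h : rowNorm s (entries T) ≤ ENNReal.ofReal x) :
    rowNorm 0 (entries T) ≤ ENNReal.ofReal (3 * x ^ (1 / (2 * s + 1))) := by
  have hx0 : 0 < x := by linarith
  -- this radius makes the two terms of the splitting equal up to constants
  have hR : 1 ≤ x ^ (2 / (2 * s + 1)) := Real.one_le_rpow hx (by positivity)
  refine (rowNorm_zero_le_split hs.le hR T).trans ?_
  calc _ ≤ ENNReal.ofReal (2 * (x ^ (2 / (2 * s + 1))) ^ (1 / 2 : ℝ) * 1) +
        ENNReal.ofReal ((x ^ (2 / (2 * s + 1))) ^ (-s)) * ENNReal.ofReal x := by gcongr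
    _ = _ := by
      rw [← ENNReal.ofReal_mul (by positivity), ← ENNReal.ofReal_add (by positivity)
        (by positivity), ← Real.rpow_mul hx0.le, ← Real.rpow_mul hx0.le]
      have h1 : x ^ (2 / (2 * s + 1) * -s) * x = x ^ (1 / (2 * s + 1)) := by
        conv_lhs => rw [← Real.rpow_one x, ← Real.rpow_mul hx0.le, ← Real.rpow_add hx0]
        congr 1
        field_simp
        ring
      have h2 : 2 / (2 * s + 1) * (1 / 2 : ℝ) = 1 / (2 * s + 1) := by ring
      rw [h1, h2]
      congr 1
      ring

end Entries

/-! ### Subexponential growth of the powers of a contraction -/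

section Growth

/-- A sequence with `x (k + 1) ≲ x k ^ (1 + γ)`, `γ < 1`, grows more slowly than `K ^ (2 ^ k)`. -/
theorem exists_le_pow_two_pow {γ K : ℝ} (hγ : 0 < γ) (hγ1 : γ < 1) (hK : 1 < K) {x : ℕ → ℝ}
    (hx : ∀ k, 1 ≤ x k) (h : ∀ k, x (k + 1) ≤ 6 * x k ^ (1 + γ)) : ∃ k, x k ≤ K ^ (2 ^ k) := by
  have hlog : ∀ k, Real.log (x (k + 1)) ≤ Real.log 6 + (1 + γ) * Real.log (x k) := fun k => by
    have h0 : 0 < x k := by linarith [hx k]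
    rw [← Real.log_rpow h0, ← Real.log_mul (by norm_num) (by positivity)]
    exact Real.log_le_log (by linarith [hx (k + 1)]) (h k)
  set D := Real.log (x 0) + Real.log 6 / γ with hD
  have hind : ∀ k, Real.log (x k) + Real.log 6 / γ ≤ (1 + γ) ^ k * D := by
    intro k
    induction k with
    | zero => simp [hD]
    | succ k ih =>
      calc _ ≤ (1 + γ) * (Real.log (x k) + Real.log 6 / γ) := by
            have : γ * (Real.log 6 / γ) = Real.log 6 := by field_simp
            linarith [hlog k]
        _ ≤ (1 + γ) * ((1 + γ) ^ k * D) := by gcongr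
        _ = _ := by ring
  have hlim : Tendsto (fun k : ℕ => ((1 + γ) / 2) ^ k * D) atTop (𝓝 (0 * D)) :=
    (tendsto_pow_atTop_nhds_zero_of_lt_one (by positivity) (by linarith)).mul_const D
  rw [zero_mul] at hlim
  obtain ⟨k, hk⟩ := (hlim.eventually_le_const (Real.log_pos hK)).exists
  refine ⟨k, ?_⟩
  have h6 : 0 ≤ Real.log 6 / γ := by positivity
  rw [← Real.log_le_log_iff (by linarith [hx k]) (by positivity), Real.log_pow]
  calc Real.log (x k) ≤ (1 + γ) ^ k * D := by linarith [hind k]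
    _ = 2 ^ k * (((1 + γ) / 2) ^ k * D) := by rw [div_pow]; field_simp
    _ ≤ _ := by push_cast; gcongr

variable {𝕜 : Type*} [RCLike 𝕜]

/-- The weighted row norm of the powers of a contraction grows subexponentially: in the weighted
Schur algebra the spectral radius does not exceed the operator norm. -/
theorem exists_rowNorm_pow_le {s : ℝ} (hs : 0 < s) (hs1 : s ≤ 1) {T : ell 𝕜 2 →L[𝕜] ell 𝕜 2}
    (hT : ‖T‖ ≤ 1) (hfin : rowNorm s (entries T) < ∞) {K : ℝ} (hK : 1 < K) :
    ∃ C : ℝ, 0 ≤ C ∧ ∀ n, rowNorm s (entries (T ^ n)) ≤ ENNReal.ofReal (C * K ^ n) := by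
  have hTn : ∀ n, ‖T ^ n‖ ≤ 1 := fun n => by
    induction n with
    | zero => exact ContinuousLinearMap.norm_id_le
    | succ n ih =>
      rw [pow_succ]
      exact (norm_mul_le _ _).trans (mul_le_one₀ ih (norm_nonneg _) hT)
  obtain ⟨k, hk⟩ : ∃ k, rowNorm s (entries (T ^ 2 ^ k)) ≤ ENNReal.ofReal (K ^ 2 ^ k) := by
    have hγ1 : 1 / (2 * s + 1) < 1 := by rw [div_lt_one (by positivity)]; linarith
    have hγ : 0 < 1 / (2 * s + 1) := by positivity
    have hf : ∀ n, rowNorm s (entries (T ^ n)) ≠ ∞ := fun n =>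
      ((rowNorm_entries_pow hs.le T n).trans_lt (ENNReal.pow_lt_top hfin)).ne
    set x : ℕ → ℝ := fun k => max 1 (rowNorm s (entries (T ^ 2 ^ k))).toReal with hx
    have hle : ∀ k, rowNorm s (entries (T ^ 2 ^ k)) ≤ ENNReal.ofReal (x k) := fun k =>
      ENNReal.le_ofReal_iff_toReal_le (hf _) (by positivity) |>.2 (le_max_right _ _)
    have hx1 : ∀ k, 1 ≤ x k := fun k => le_max_left _ _
    obtain ⟨k, hk⟩ := exists_le_pow_two_pow hγ hγ1 hK hx1 fun k => by
      have hx0 : 0 < x k := by linarith [hx1 k]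
      have h1 : 1 ≤ 6 * x k ^ (1 + 1 / (2 * s + 1)) := by
        have := Real.one_le_rpow (hx1 k) (z := 1 + 1 / (2 * s + 1)) (by positivity)
        linarith
      refine max_le h1 (ENNReal.toReal_le_of_le_ofReal (by positivity) ?_)
      have := rowNorm_entries_mul_self hs.le hs1 (T ^ 2 ^ k)
      rw [← pow_add, ← two_mul, ← pow_succ'] at this
      refine this.trans ?_
      calc _ ≤ ENNReal.ofReal 2 * ENNReal.ofReal (3 * x k ^ (1 / (2 * s + 1))) *
            ENNReal.ofReal (x k) := by
            rw [ENNReal.ofReal_ofNat]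
            gcongr
            · exact rowNorm_zero_le_rpow hs (hx1 k) (hTn _) (hle k)
            · exact hle k
        _ = _ := by
          rw [← ENNReal.ofReal_mul (by positivity), ← ENNReal.ofReal_mul (by positivity),
            Real.rpow_add hx0, Real.rpow_one]
          congr 1
          ring
    exact ⟨k, (hle k).trans (ENNReal.ofReal_le_ofReal hk)⟩
  set m := 2 ^ k with hm
  have hm0 : 0 < m := by positivity
  set X := max 1 (rowNorm s (entries T)).toReal with hX
  have hX1 : 1 ≤ X := le_max_left _ _
  have hXle : rowNorm s (entries T) ≤ ENNReal.ofReal X :=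
    ENNReal.le_ofReal_iff_toReal_le hfin.ne (by positivity) |>.2 (le_max_right _ _)
  refine ⟨X ^ m, by positivity, fun n => ?_⟩
  calc rowNorm s (entries (T ^ n))
      = rowNorm s (entries ((T ^ m) ^ (n / m) * T ^ (n % m))) := by
        rw [← pow_mul, ← pow_add, Nat.div_add_mod]
    _ ≤ rowNorm s (entries (T ^ m)) ^ (n / m) * rowNorm s (entries T) ^ (n % m) :=
        (rowNorm_entries_mul hs.le _ _).trans
          (mul_le_mul' (rowNorm_entries_pow hs.le _ _) (rowNorm_entries_pow hs.le _ _))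
    _ ≤ ENNReal.ofReal (K ^ m) ^ (n / m) * ENNReal.ofReal X ^ (n % m) := by gcongr
    _ = ENNReal.ofReal (K ^ (m * (n / m)) * X ^ (n % m)) := by
        rw [← ENNReal.ofReal_pow (by positivity), ← ENNReal.ofReal_pow (by positivity),
          ← ENNReal.ofReal_mul (by positivity), ← pow_mul]
    _ ≤ ENNReal.ofReal (X ^ m * K ^ n) := by
        rw [mul_comm (X ^ m)]
        refine ENNReal.ofReal_le_ofReal (mul_le_mul ?_ ?_ (by positivity) (by positivity))
        · exact pow_le_pow_right₀ hK.le (Nat.mul_div_le n m)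
        · exact pow_le_pow_right₀ hX1 (Nat.mod_lt n hm0).le

/-- If the operator norms of `M n` decay exponentially and the weighted row norms grow
subexponentially, then the unweighted row norms decay exponentially. -/
theorem exists_rowNorm_zero_le_geometric {s : ℝ} (hs : 0 < s) (hs1 : s ≤ 1)
    {M : ℕ → ell 𝕜 2 →L[𝕜] ell 𝕜 2} {q b : ℝ} (hq : 0 < q) (hq1 : q < 1)
    (hM : ∀ n, ‖M n‖ ≤ b * q ^ n)
    (hsub : ∀ K : ℝ, 1 < K → ∃ C : ℝ, 0 ≤ C ∧
      ∀ n, rowNorm s (entries (M n)) ≤ ENNReal.ofReal (C * K ^ n)) :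
    ∃ C r : ℝ, 0 ≤ C ∧ 0 ≤ r ∧ r < 1 ∧
      ∀ n, rowNorm 0 (entries (M n)) ≤ ENNReal.ofReal (C * r ^ n) := by
  have hb : 0 ≤ b := by simpa using (norm_nonneg _).trans (hM 0)
  have hK : 1 < q ^ (-(s / 2)) := Real.one_lt_rpow_of_pos_of_lt_one_of_neg hq hq1 (by linarith)
  obtain ⟨C, hC, h⟩ := hsub _ hK
  refine ⟨2 * b + C, q ^ (s / 2), by positivity, by positivity,
    Real.rpow_lt_one hq.le hq1 (by positivity), fun n => ?_⟩
  -- the rows of `M n` are split at distance `q⁻¹ ^ n`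
  have hR : 1 ≤ q⁻¹ ^ n := one_le_pow₀ ((one_le_inv₀ hq).2 hq1.le)
  refine (rowNorm_zero_le_split hs.le hR (M n)).trans ?_
  have e1 : (q⁻¹ ^ n) ^ (1 / 2 : ℝ) * q ^ n ≤ (q ^ (s / 2)) ^ n := by
    rw [← Real.rpow_natCast (q ^ (s / 2)), ← Real.rpow_natCast q, ← Real.rpow_natCast q⁻¹,
      ← Real.rpow_mul hq.le, ← Real.rpow_mul (by positivity), Real.inv_rpow hq.le,
      ← Real.rpow_neg hq.le, ← Real.rpow_add hq]
    refine Real.rpow_le_rpow_of_exponent_ge hq hq1.le ?_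
    have : (0 : ℝ) ≤ n := Nat.cast_nonneg n
    nlinarith
  have e2 : (q⁻¹ ^ n) ^ (-s) * (q ^ (-(s / 2))) ^ n = (q ^ (s / 2)) ^ n := by
    rw [← Real.rpow_natCast (q ^ (s / 2)), ← Real.rpow_natCast (q ^ (-(s / 2))),
      ← Real.rpow_natCast q⁻¹, ← Real.rpow_mul hq.le, ← Real.rpow_mul hq.le,
      ← Real.rpow_mul (by positivity), Real.inv_rpow hq.le, ← Real.rpow_neg hq.le,
      ← Real.rpow_add hq]
    congr 1
    ring
  calc _ ≤ ENNReal.ofReal (2 * (q⁻¹ ^ n) ^ (1 / 2 : ℝ) * (b * q ^ n)) +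
        ENNReal.ofReal ((q⁻¹ ^ n) ^ (-s)) * ENNReal.ofReal (C * (q ^ (-(s / 2))) ^ n) := by
        gcongr
        · exact hM n
        · exact h n
    _ ≤ _ := by
        rw [← ENNReal.ofReal_mul (by positivity), ← ENNReal.ofReal_add (by positivity)
          (by positivity)]
        refine ENNReal.ofReal_le_ofReal ?_
        calc _ = 2 * b * ((q⁻¹ ^ n) ^ (1 / 2 : ℝ) * q ^ n) +
              C * ((q⁻¹ ^ n) ^ (-s) * (q ^ (-(s / 2))) ^ n) := by ring
          _ ≤ 2 * b * (q ^ (s / 2)) ^ n + C * (q ^ (s / 2)) ^ n := by rw [e2]; gcongr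
          _ = _ := by ring

end Growth

/-! ### Localization of the canonical dual frame -/

section Neumann

variable {𝕜 E F : Type*} [RCLike 𝕜] [NormedAddCommGroup E] [InnerProductSpace 𝕜 E]
  [CompleteSpace E] [NormedAddCommGroup F] [InnerProductSpace 𝕜 F] [CompleteSpace F]

open ContinuousLinearMap in
theorem norm_sub_smul_sq (c : ℝ) (C : E →L[𝕜] F) (f : E) :
    ‖f - (c : 𝕜) • adjoint C (C f)‖ ^ 2 =
      ‖f‖ ^ 2 - 2 * c * ‖C f‖ ^ 2 + c ^ 2 * ‖adjoint C (C f)‖ ^ 2 := by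
  rw [@norm_sub_sq 𝕜, inner_smul_right, adjoint_inner_right, norm_smul, mul_pow,
    inner_self_eq_norm_sq_to_K, RCLike.norm_ofReal, sq_abs, ← RCLike.ofReal_pow,
    ← RCLike.ofReal_mul, RCLike.ofReal_re]
  ring

open ContinuousLinearMap in
/-- For an operator `C` which is bounded below and a suitable step `c`, the operator `1 - c C* C` is
a strict contraction while `1 - c C C*`, which is the identity on the kernel of `C*`, is still a
contraction. -/
theorem exists_step (C : E →L[𝕜] F) {A : ℝ} (hA : 0 < A) (h : ∀ f, A * ‖f‖ ^ 2 ≤ ‖C f‖ ^ 2) :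
    ∃ c q : ℝ, 0 < c ∧ 0 < q ∧ q < 1 ∧ ‖1 - (c : 𝕜) • (adjoint C ∘L C)‖ ≤ q ∧
      ‖1 - (c : 𝕜) • (C ∘L adjoint C)‖ ≤ 1 := by
  set N := ‖C‖ ^ 2 + A with hN
  have hN0 : 0 < N := by positivity
  have hAN : A ≤ N := by rw [hN]; linarith [sq_nonneg ‖C‖]
  have hCN : ‖C‖ ^ 2 ≤ N := by rw [hN]; linarith
  -- any `c` with `c * ‖C‖ ^ 2 ≤ 1` would do; this choice also covers `C = 0`
  set c := A / N ^ 2 with hc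
  have hc0 : 0 < c := by positivity
  have hcC : c * ‖C‖ ^ 2 ≤ 1 := by
    rw [hc, div_mul_eq_mul_div, div_le_one (by positivity), sq N]
    exact mul_le_mul hAN hCN (by positivity) hN0.le
  have hadj : ‖adjoint C‖ = ‖C‖ := LinearIsometryEquiv.norm_map _ _
  have hle : A ^ 2 / N ^ 2 ≤ 1 := (div_le_one (by positivity)).2 (by gcongr)
  set d := A ^ 2 / N ^ 2 with hd
  have hd0 : 0 < d := by positivity
  refine ⟨c, 1 - d / 4, hc0, by linarith, by linarith, ?_, ?_⟩
  · refine opNorm_le_bound _ (by linarith) fun f => ?_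
    refine abs_le_of_sq_le_sq' ?_ (mul_nonneg (by linarith) (norm_nonneg _)) |>.2
    change ‖f - (c : 𝕜) • adjoint C (C f)‖ ^ 2 ≤ _
    rw [norm_sub_smul_sq]
    have h1 : ‖adjoint C (C f)‖ ^ 2 ≤ ‖C‖ ^ 2 * ‖C f‖ ^ 2 := by
      rw [← mul_pow, ← hadj]
      gcongr
      exact le_opNorm _ _
    have h2 : c ^ 2 * ‖adjoint C (C f)‖ ^ 2 ≤ c * ‖C f‖ ^ 2 := by
      calc _ ≤ c ^ 2 * (‖C‖ ^ 2 * ‖C f‖ ^ 2) := by gcongr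
        _ = c * (c * ‖C‖ ^ 2) * ‖C f‖ ^ 2 := by ring
        _ ≤ c * 1 * ‖C f‖ ^ 2 := by gcongr
        _ = _ := by ring
    have h3 : d * ‖f‖ ^ 2 ≤ c * ‖C f‖ ^ 2 := by
      calc d * ‖f‖ ^ 2 = c * (A * ‖f‖ ^ 2) := by rw [hd, hc]; ring
        _ ≤ _ := by gcongr; exact h f
    rw [mul_pow]
    have h4 : (1 - d) * ‖f‖ ^ 2 ≤ (1 - d / 4) ^ 2 * ‖f‖ ^ 2 := by
      gcongr
      nlinarith
    linarith
  · refine opNorm_le_bound _ zero_le_one fun f => ?_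
    rw [one_mul]
    refine abs_le_of_sq_le_sq' ?_ (norm_nonneg _) |>.2
    have h0 := norm_sub_smul_sq c (adjoint C) f
    rw [adjoint_adjoint] at h0
    change ‖f - (c : 𝕜) • C (adjoint C f)‖ ^ 2 ≤ _
    rw [h0]
    have h1 : ‖C (adjoint C f)‖ ^ 2 ≤ ‖C‖ ^ 2 * ‖adjoint C f‖ ^ 2 := by
      rw [← mul_pow]
      gcongr
      exact le_opNorm _ _
    have h2 : c ^ 2 * ‖C (adjoint C f)‖ ^ 2 ≤ c * ‖adjoint C f‖ ^ 2 := by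
      calc _ ≤ c ^ 2 * (‖C‖ ^ 2 * ‖adjoint C f‖ ^ 2) := by gcongr
        _ = c * (c * ‖C‖ ^ 2) * ‖adjoint C f‖ ^ 2 := by ring
        _ ≤ c * 1 * ‖adjoint C f‖ ^ 2 := by gcongr
        _ = _ := by ring
    have h3 : 0 ≤ c * ‖adjoint C f‖ ^ 2 := by positivity
    linarith

open ContinuousLinearMap in
/-- The Landweber iterates of `C* C` and of `C C*` intertwine. -/
theorem pow_comp_comp_adjoint (c : 𝕜) (C : E →L[𝕜] F) (n : ℕ) :
    (1 - c • (C ∘L adjoint C)) ^ n * (C ∘L adjoint C) =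
      C ∘L ((1 - c • (adjoint C ∘L C)) ^ n : E →L[𝕜] E) ∘L adjoint C := by
  have h : ∀ n : ℕ, ∀ f, ((1 - c • (C ∘L adjoint C)) ^ n) (C f) =
      C (((1 - c • (adjoint C ∘L C)) ^ n) f) := by
    intro n
    induction n with
    | zero => intro f; rfl
    | succ n ih =>
      intro f
      rw [pow_succ, pow_succ]
      change ((1 - c • (C ∘L adjoint C)) ^ n) (C f - c • C (adjoint C (C f))) =
        C (((1 - c • (adjoint C ∘L C)) ^ n) (f - c • adjoint C (C f)))
      rw [← ih, map_sub C, map_smul C]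
  ext1 v
  exact h n _

end Neumann

section Dual

variable {𝕜 H : Type*} [RCLike 𝕜] [NormedAddCommGroup H] [InnerProductSpace 𝕜 H]
  [CompleteSpace H] (g : ℤ → H) (hg : IsFrame 𝕜 g)

theorem adjoint_inverse_frameOp :
    ContinuousLinearMap.adjoint (Ring.inverse (frameOp g hg)) = Ring.inverse (frameOp g hg) := by
  have hsa : star (frameOp g hg) = frameOp g hg := by
    simp [ContinuousLinearMap.star_eq_adjoint, frameOp, ContinuousLinearMap.adjoint_comp]
  rw [← ContinuousLinearMap.star_eq_adjoint, ← Ring.inverse_star, hsa]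

/-- The Neumann series of `S⁻²` around `c⁻¹`. -/
theorem hasSum_inverse_sq {R : Type*} [NormedRing R] [CompleteSpace R] [NormedAlgebra 𝕜 R]
    (S : R) {c : 𝕜} (hS : ‖1 - c • S‖ < 1) :
    HasSum (fun n : ℕ => (c ^ 2 * (n + 1) : 𝕜) • (1 - c • S) ^ n)
      (Ring.inverse S * Ring.inverse S) := by
  set t := 1 - c • S with ht
  have hsum : Summable fun n : ℕ => ‖t ^ n‖ := by
    refine Summable.of_norm_bounded_eventually_nat (summable_geometric_of_lt_one
      (norm_nonneg t) hS) ?_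
    filter_upwards [eventually_gt_atTop 0] with n hn
    simpa using norm_pow_le' t hn
  have h1 : (∑' n : ℕ, t ^ n) * (1 - t) = 1 := hsum.of_norm.tsum_pow_mul_one_sub
  have h2 : (1 - t) * (∑' n : ℕ, t ^ n) = 1 := hsum.of_norm.one_sub_mul_tsum_pow
  have h1t : 1 - t = c • S := by rw [ht]; abel
  rw [h1t] at h1 h2
  have hinv : Ring.inverse S = c • ∑' n : ℕ, t ^ n := by
    have hu : IsUnit S := ⟨⟨S, c • ∑' n : ℕ, t ^ n, by rw [mul_smul_comm, ← smul_mul_assoc, h2],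
      by rw [smul_mul_assoc, ← mul_smul_comm, h1]⟩, rfl⟩
    calc Ring.inverse S = (c • ∑' n : ℕ, t ^ n) * S * Ring.inverse S := by
          rw [smul_mul_assoc, ← mul_smul_comm, h1, one_mul]
      _ = _ := by rw [mul_assoc, Ring.mul_inverse_cancel _ hu, mul_one]
  have hprod := tsum_mul_tsum_eq_tsum_sum_antidiagonal_of_summable_norm hsum hsum
  have hs2 := (summable_norm_sum_mul_antidiagonal_of_summable_norm hsum hsum).of_norm
  have hterm : ∀ n : ℕ, ∑ kl ∈ Finset.HasAntidiagonal.antidiagonal n, t ^ kl.1 * t ^ kl.2 =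
      (n + 1 : 𝕜) • t ^ n := by
    intro n
    rw [Finset.sum_congr rfl (g := fun _ => t ^ n) fun kl hkl => by
      rw [← pow_add, Finset.HasAntidiagonal.mem_antidiagonal.1 hkl], Finset.sum_const,
      Finset.Nat.card_antidiagonal, ← Nat.cast_smul_eq_nsmul 𝕜]
    push_cast
    rfl
  simp only [hterm] at hprod hs2
  have h := hs2.hasSum.const_smul (c ^ 2)
  rw [← hprod] at h
  simp only [smul_smul] at h
  rwa [hinv, smul_mul_smul_comm, ← sq]

theorem entries_gram (k l : ℤ) :
    entries (analysisOp g hg ∘L ContinuousLinearMap.adjoint (analysisOp g hg)) k l =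
      gram 𝕜 g g l k := by
  change analysisOp g hg (ContinuousLinearMap.adjoint (analysisOp g hg) (lp.single 2 l 1)) k = _
  rw [adjoint_analysisOp_single, one_smul]
  rfl

theorem entries_gram_dual (k l : ℤ) :
    entries (analysisOp g hg ∘L (Ring.inverse (frameOp g hg) * Ring.inverse (frameOp g hg)) ∘L
      ContinuousLinearMap.adjoint (analysisOp g hg)) k l =
      gram 𝕜 (dual g hg) (dual g hg) l k := by
  change analysisOp g hg (Ring.inverse (frameOp g hg) (Ring.inverse (frameOp g hg)
    (ContinuousLinearMap.adjoint (analysisOp g hg) (lp.single 2 l 1)))) k = _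
  rw [adjoint_analysisOp_single, one_smul]
  change pair 𝕜 (Ring.inverse (frameOp g hg) (dual g hg l)) (g k) =
    pair 𝕜 (dual g hg l) (dual g hg k)
  rw [pair_dual, adjoint_inverse_frameOp]

omit [CompleteSpace H] in
theorem norm_pair_comm (f h : H) : ‖pair 𝕜 f h‖ = ‖pair 𝕜 h f‖ := norm_inner_symm _ _

/-- The row norm is countably subadditive for series of operators. -/
theorem rowNorm_entries_le_tsum {D : ℕ → ell 𝕜 2 →L[𝕜] ell 𝕜 2} {T : ell 𝕜 2 →L[𝕜] ell 𝕜 2}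
    (h : HasSum D T) : rowNorm 0 (entries T) ≤ ∑' n, rowNorm 0 (entries (D n)) := by
  refine iSup_le fun k => ?_
  have hpt : ∀ l, ‖entries T k l‖ₑ ≤ ∑' n, ‖entries (D n) k l‖ₑ := fun l => by
    have := h.mapL ((lp.evalCLM 𝕜 (fun _ : ℤ => 𝕜) 2 k) ∘L
      (ContinuousLinearMap.apply 𝕜 (ell 𝕜 2) (lp.single 2 l (1 : 𝕜))))
    change HasSum (fun n => entries (D n) k l) (entries T k l) at this
    rw [← this.tsum_eq]
    exact enorm_tsum_le_tsum_enorm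
  simp only [weight_zero, mul_one]
  refine (ENNReal.tsum_le_tsum hpt).trans ?_
  rw [ENNReal.tsum_comm]
  exact ENNReal.tsum_le_tsum fun n => row_le_rowNorm_zero _ k

/-- The canonical dual of an intrinsically localized frame is intrinsically localized. Its Gramian
is `C S⁻² C* = c² ∑ₙ (n + 1) (1 - c C C*)ⁿ C C*`, where `C` is the analysis operator. The factors
`(1 - c C C*)ⁿ C C*` decay exponentially in operator norm and grow at most subexponentially in the
weighted norm. -/
theorem schurNorm_gram_dual_lt_top {s : ℝ} (hs : 0 < s) (h : schurNorm s (gram 𝕜 g g) < ∞) :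
    schurNorm 0 (gram 𝕜 (dual g hg) (dual g hg)) < ∞ := by
  wlog hs1 : s ≤ 1 generalizing s
  · exact this one_pos ((schurNorm_mono_exponent (not_le.1 hs1).le _).trans_lt h) le_rfl
  obtain ⟨A, B, hA, hAB, hAf⟩ := id hg
  set C := analysisOp g hg with hC
  have hlow : ∀ f, A * ‖f‖ ^ 2 ≤ ‖C f‖ ^ 2 := fun f =>
    (hAf f).2.1.trans_eq (hg.norm_sq f).symm
  obtain ⟨c, q, hc, hq, hq1, hS, hT⟩ := exists_step C hA hlow
  set Γ : ell 𝕜 2 →L[𝕜] ell 𝕜 2 := C ∘L ContinuousLinearMap.adjoint C with hΓ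
  set T : ell 𝕜 2 →L[𝕜] ell 𝕜 2 := 1 - (c : 𝕜) • Γ with hTdef
  have hΓfin : rowNorm s (entries Γ) < ∞ := by
    have : entries Γ = (gram 𝕜 g g).transpose := by ext k l; exact entries_gram g hg k l
    rw [this]
    exact (le_max_right _ _).trans_lt ((schurNorm_eq s _).symm.trans_lt h)
  have hTfin : rowNorm s (entries T) < ∞ := by
    have : entries T = entries (1 : ell 𝕜 2 →L[𝕜] ell 𝕜 2) + (-c : 𝕜) • entries Γ := by
      rw [← entries_smul, ← entries_add, neg_smul, ← sub_eq_add_neg]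
    rw [this]
    refine (rowNorm_add_le _ _ _).trans_lt (ENNReal.add_lt_top.2
      ⟨(rowNorm_entries_one_le s).trans_lt ENNReal.one_lt_top, ?_⟩)
    rw [rowNorm_smul]
    exact ENNReal.mul_lt_top enorm_lt_top hΓfin
  have hMeq : ∀ n, T ^ n * Γ =
      C ∘L ((1 - (c : 𝕜) • frameOp g hg) ^ n : H →L[𝕜] H) ∘L
        ContinuousLinearMap.adjoint C :=
    fun n => pow_comp_comp_adjoint (c : 𝕜) C n
  have hSn : ∀ n : ℕ, ‖(1 - (c : 𝕜) • frameOp g hg) ^ n‖ ≤ q ^ n := fun n => by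
    induction n with
    | zero =>
      rw [pow_zero, pow_zero]
      exact ContinuousLinearMap.norm_id_le
    | succ n ih =>
      rw [pow_succ, pow_succ]
      exact (norm_mul_le _ _).trans (mul_le_mul ih hS (norm_nonneg _) (by positivity))
  obtain ⟨D, r, hD, hr, hr1, hdecay⟩ := exists_rowNorm_zero_le_geometric hs hs1
    (M := fun n => T ^ n * Γ) (b := ‖C‖ * ‖ContinuousLinearMap.adjoint C‖) hq hq1
    (fun n => by
      simp only [hMeq]
      refine (ContinuousLinearMap.opNorm_comp_le _ _).trans ?_
      rw [mul_assoc]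
      gcongr
      refine (ContinuousLinearMap.opNorm_comp_le _ _).trans ?_
      rw [mul_comm]
      gcongr
      exact hSn n)
    (fun K hK => by
      obtain ⟨D, hD, h⟩ := exists_rowNorm_pow_le hs hs1 hT hTfin hK
      refine ⟨D * (rowNorm s (entries Γ)).toReal, by positivity, fun n => ?_⟩
      refine (rowNorm_entries_mul hs.le _ _).trans ((mul_le_mul_left (h n) _).trans_eq ?_)
      rw [mul_right_comm, ENNReal.ofReal_mul (by positivity) (q := (rowNorm s (entries Γ)).toReal),
        ENNReal.ofReal_toReal hΓfin.ne])
  have hser := hasSum_inverse_sq (frameOp g hg) (c := (c : 𝕜)) (hS.trans_lt hq1)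
  have hser2 := (hser.mapL ((ContinuousLinearMap.compL 𝕜 (ell 𝕜 2) H (ell 𝕜 2) C) ∘L
    ((ContinuousLinearMap.compL 𝕜 (ell 𝕜 2) H H).flip (ContinuousLinearMap.adjoint C))))
  change HasSum (fun n : ℕ => C ∘L
      (((c : 𝕜) ^ 2 * (n + 1)) • (1 - (c : 𝕜) • frameOp g hg) ^ n : H →L[𝕜] H) ∘L
    ContinuousLinearMap.adjoint C) (C ∘L (Ring.inverse (frameOp g hg) *
      Ring.inverse (frameOp g hg)) ∘L ContinuousLinearMap.adjoint C) at hser2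
  have hterm : ∀ n : ℕ, C ∘L
      (((c : 𝕜) ^ 2 * (n + 1)) • (1 - (c : 𝕜) • frameOp g hg) ^ n : H →L[𝕜] H) ∘L
      ContinuousLinearMap.adjoint C = ((c : 𝕜) ^ 2 * (n + 1)) • (T ^ n * Γ) := fun n => by
    rw [hMeq, ContinuousLinearMap.smul_comp, ContinuousLinearMap.comp_smul]
  simp only [hterm] at hser2
  have hsymm := schurNorm_eq_of_norm_swap 0 (fun k l => congrArg norm (entries_gram_dual g hg k l))
  rw [← hsymm, schurNorm_eq_rowNorm_of_norm_symm 0 fun k l => by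
    rw [entries_gram_dual, entries_gram_dual]; exact norm_pair_comm _ _]
  refine (rowNorm_entries_le_tsum hser2).trans_lt ?_
  have hsummable : Summable fun n : ℕ => c ^ 2 * (n + 1) * (D * r ^ n) := by
    have h1 := (summable_pow_mul_geometric_of_norm_lt_one 1 (r := r)
      (by rwa [Real.norm_of_nonneg hr])).mul_left (c ^ 2 * D)
    have h2 := (summable_geometric_of_lt_one hr hr1).mul_left (c ^ 2 * D)
    refine (h1.add h2).congr fun n => ?_
    ring
  refine lt_of_le_of_lt (ENNReal.tsum_le_tsum fun n => ?_)
    (hsummable.tsum_ofReal_lt_top)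
  rw [entries_smul, rowNorm_smul, ENNReal.ofReal_mul (by positivity)]
  gcongr
  · rw [← ofReal_norm]
    refine ENNReal.ofReal_le_ofReal ?_
    rw [norm_mul, norm_pow, RCLike.norm_ofReal, sq_abs]
    gcongr
    exact_mod_cast (RCLike.norm_natCast (K := 𝕜) (n + 1)).le
  · exact hdecay n

end Dual

/-! ### The action of Schur class matrices on `ℓ^p` -/

section Action

variable {𝕜 : Type*} [RCLike 𝕜]

theorem summable_of_tsum_enorm_ne_top {ι E : Type*} [NormedAddCommGroup E] [CompleteSpace E]
    {f : ι → E} (h : ∑' i, ‖f i‖ₑ ≠ ∞) : Summable f :=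
  .of_nnnorm (ENNReal.tsum_coe_ne_top_iff_summable.1 h)

theorem memℓp_of_tsum_enorm_ne_top {p : ℝ≥0∞} {v : ℤ → 𝕜}
    (h : ∑' n, ‖v n‖ₑ ^ p.toReal ≠ ∞) : Memℓp v p := by
  refine memℓp_gen ?_
  refine (ENNReal.summable_toReal h).congr fun n => ?_
  rw [← ENNReal.toReal_rpow, toReal_enorm]

theorem enorm_rpow_eq_tsum {p : ℝ≥0∞} [Fact (1 ≤ p)] (hp : 0 < p.toReal) (v : ell 𝕜 p) :
    ‖v‖ₑ ^ p.toReal = ∑' n, ‖v n‖ₑ ^ p.toReal := by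
  rw [← ofReal_norm, ENNReal.ofReal_rpow_of_nonneg (norm_nonneg _) hp.le,
    lp.norm_rpow_eq_tsum hp, ENNReal.ofReal_tsum_of_nonneg (fun _ => by positivity)
      (lp.memℓp v |>.summable hp)]
  exact tsum_congr fun n => by
    rw [← ofReal_norm, ENNReal.ofReal_rpow_of_nonneg (norm_nonneg _) hp.le]

theorem enorm_apply_le {p : ℝ≥0∞} [Fact (1 ≤ p)] (v : ell 𝕜 p) (n : ℤ) : ‖v n‖ₑ ≤ ‖v‖ₑ := by
  rw [← ofReal_norm, ← ofReal_norm]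
  exact ENNReal.ofReal_le_ofReal
    (lp.norm_apply_le_norm (zero_lt_one.trans_le Fact.out).ne' v n)

theorem row_le_schurNorm (a : Matrix ℤ ℤ 𝕜) (n : ℤ) : ∑' x, ‖a n x‖ₑ ≤ schurNorm 0 a :=
  (row_le_rowNorm_zero a n).trans ((schurNorm_eq 0 a).symm ▸ le_max_left _ _)

theorem col_le_schurNorm (a : Matrix ℤ ℤ 𝕜) (x : ℤ) : ∑' n, ‖a n x‖ₑ ≤ schurNorm 0 a :=
  (row_le_rowNorm_zero a.transpose x).trans ((schurNorm_eq 0 a).symm ▸ le_max_right _ _)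

/-- Jensen's inequality for a weighted series. -/
theorem tsum_mul_rpow_le {r : ℝ} (hr : 1 ≤ r) (w f : ℤ → ℝ≥0∞) {W : ℝ≥0∞} (hW : ∑' n, w n ≤ W) :
    (∑' n, w n * f n) ^ r ≤ W ^ (r - 1) * ∑' n, w n * f n ^ r := by
  have hr0 : 0 < r := by linarith
  have h : ∑' n, w n * f n ≤ W ^ (1 - r⁻¹) * (∑' n, w n * f n ^ r) ^ r⁻¹ := by
    rw [ENNReal.tsum_eq_iSup_sum]
    refine iSup_le fun s => (ENNReal.inner_le_weight_mul_Lp_of_nonneg s hr w f).trans ?_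
    have h1 : 0 ≤ 1 - r⁻¹ := sub_nonneg.2 (inv_le_one_of_one_le₀ hr)
    gcongr
    · exact (ENNReal.sum_le_tsum s).trans hW
    · exact ENNReal.sum_le_tsum s
  calc _ ≤ (W ^ (1 - r⁻¹) * (∑' n, w n * f n ^ r) ^ r⁻¹) ^ r := by gcongr
    _ = _ := by
      rw [ENNReal.mul_rpow_of_nonneg _ _ hr0.le, ← ENNReal.rpow_mul, ← ENNReal.rpow_mul,
        inv_mul_cancel₀ hr0.ne', ENNReal.rpow_one]
      congr 2
      field_simp

variable {a b c : Matrix ℤ ℤ 𝕜} {p : ℝ≥0∞} [Fact (1 ≤ p)]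

theorem enorm_tsum_mul_le (a : Matrix ℤ ℤ 𝕜) (v : ℤ → 𝕜) (x : ℤ) :
    ‖∑' n, v n * a n x‖ₑ ≤ ∑' n, ‖a n x‖ₑ * ‖v n‖ₑ :=
  enorm_tsum_le_tsum_enorm.trans_eq (tsum_congr fun n => by rw [enorm_mul, mul_comm])

/-- Schur's test. -/
theorem tsum_enorm_vecMul_rpow_le (a : Matrix ℤ ℤ 𝕜) {r : ℝ} (hr : 1 ≤ r) (v : ℤ → 𝕜) :
    ∑' x, ‖∑' n, v n * a n x‖ₑ ^ r ≤ schurNorm 0 a ^ r * ∑' n, ‖v n‖ₑ ^ r := by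
  have hr1 : 0 ≤ r - 1 := by linarith
  calc ∑' x, ‖∑' n, v n * a n x‖ₑ ^ r
      ≤ ∑' x, schurNorm 0 a ^ (r - 1) * ∑' n, ‖a n x‖ₑ * ‖v n‖ₑ ^ r := by
        refine ENNReal.tsum_le_tsum fun x => ?_
        refine le_trans ?_ (tsum_mul_rpow_le hr _ _ (col_le_schurNorm a x))
        gcongr
        exact enorm_tsum_mul_le a v x
    _ = schurNorm 0 a ^ (r - 1) * ∑' n, (∑' x, ‖a n x‖ₑ) * ‖v n‖ₑ ^ r := by
        rw [ENNReal.tsum_mul_left, ENNReal.tsum_comm]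
        simp only [ENNReal.tsum_mul_right]
    _ ≤ schurNorm 0 a ^ (r - 1) * ∑' n, schurNorm 0 a * ‖v n‖ₑ ^ r := by
        gcongr with n
        exact row_le_schurNorm a n
    _ = _ := by
        rw [ENNReal.tsum_mul_left, ← mul_assoc]
        congr 1
        conv_lhs => rw [← ENNReal.rpow_one (schurNorm 0 a), ← ENNReal.rpow_mul, one_mul,
          ← ENNReal.rpow_add_of_nonneg _ _ hr1 zero_le_one]
        congr 1
        ring

theorem toReal_exponent {p : ℝ≥0∞} [Fact (1 ≤ p)] (hp : p ≠ ∞) : 1 ≤ p.toReal := by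
  rw [← ENNReal.toReal_one]
  exact ENNReal.toReal_mono hp Fact.out

theorem enorm_vecMul_le (a : Matrix ℤ ℤ 𝕜) (v : ell 𝕜 ∞) (x : ℤ) :
    ‖∑' n, v n * a n x‖ₑ ≤ schurNorm 0 a * ‖v‖ₑ := by
  refine (enorm_tsum_mul_le a v x).trans ?_
  calc _ ≤ ∑' n, ‖a n x‖ₑ * ‖v‖ₑ :=
        ENNReal.tsum_le_tsum fun n => by gcongr; exact enorm_apply_le v n
    _ ≤ _ := by
        rw [ENNReal.tsum_mul_right]
        gcongr
        exact col_le_schurNorm a x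

theorem memℓp_vecMul (ha : schurNorm 0 a < ∞) (v : ell 𝕜 p) :
    Memℓp (fun x => ∑' n, v n * a n x) p := by
  rcases eq_or_ne p ∞ with rfl | hp
  · refine memℓp_infty ⟨(schurNorm 0 a * ‖v‖ₑ).toReal, ?_⟩
    rintro _ ⟨x, rfl⟩
    change ‖∑' n, v n * a n x‖ ≤ _
    rw [← toReal_enorm]
    exact ENNReal.toReal_mono (ENNReal.mul_ne_top ha.ne enorm_ne_top) (enorm_vecMul_le a v x)
  · have hp1 := toReal_exponent hp
    refine memℓp_of_tsum_enorm_ne_top ?_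
    refine ((tsum_enorm_vecMul_rpow_le a hp1 v).trans_lt ?_).ne
    rw [← enorm_rpow_eq_tsum (by linarith)]
    exact ENNReal.mul_lt_top (ENNReal.rpow_lt_top_of_nonneg (by linarith) ha.ne)
      (ENNReal.rpow_lt_top_of_nonneg (by linarith) enorm_ne_top)

theorem norm_vecMul_le (ha : schurNorm 0 a < ∞) (v : ell 𝕜 p) :
    ‖(⟨_, memℓp_vecMul ha v⟩ : ell 𝕜 p)‖ ≤ (schurNorm 0 a).toReal * ‖v‖ := by
  rcases eq_or_ne p ∞ with rfl | hp
  · refine lp.norm_le_of_forall_le (by positivity) fun x => ?_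
    rw [← toReal_enorm, ← toReal_enorm (x := v), ← ENNReal.toReal_mul]
    exact ENNReal.toReal_mono (ENNReal.mul_ne_top ha.ne enorm_ne_top) (enorm_vecMul_le a v x)
  · have hp1 := toReal_exponent hp
    rw [← toReal_enorm, ← toReal_enorm (x := v), ← ENNReal.toReal_mul]
    refine ENNReal.toReal_mono (ENNReal.mul_ne_top ha.ne enorm_ne_top) ?_
    have hp0 : 0 < p.toReal := by linarith
    rw [← ENNReal.rpow_le_rpow_iff hp0, ENNReal.mul_rpow_of_nonneg _ _ hp0.le,
      enorm_rpow_eq_tsum hp0, enorm_rpow_eq_tsum hp0]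
    exact tsum_enorm_vecMul_rpow_le a hp1 v

theorem summable_mul_col (ha : schurNorm 0 a < ∞) (v : ell 𝕜 p) (x : ℤ) :
    Summable fun n => v n * a n x := by
  refine summable_of_tsum_enorm_ne_top (ne_top_of_le_ne_top (b := ‖v‖ₑ * schurNorm 0 a)
    (ENNReal.mul_ne_top enorm_ne_top ha.ne) ?_)
  calc ∑' n, ‖v n * a n x‖ₑ ≤ ∑' n, ‖v‖ₑ * ‖a n x‖ₑ := ENNReal.tsum_le_tsum fun n => by
        rw [enorm_mul]; gcongr; exact enorm_apply_le v n
    _ ≤ _ := by rw [ENNReal.tsum_mul_left]; gcongr; exact col_le_schurNorm a x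

/-- The operator `v ↦ (∑ₙ vₙ aₙₓ)ₓ` on `ℓ^p` given by a matrix in the Schur algebra, acting on row
vectors. -/
noncomputable def act (p : ℝ≥0∞) [Fact (1 ≤ p)] (ha : schurNorm 0 a < ∞) :
    ell 𝕜 p →L[𝕜] ell 𝕜 p :=
  LinearMap.mkContinuous
    { toFun := fun v => ⟨fun x => ∑' n, v n * a n x, memℓp_vecMul ha v⟩
      map_add' := fun v w => by
        ext x
        change ∑' n, (v n + w n) * a n x = (∑' n, v n * a n x) + ∑' n, w n * a n x
        rw [← (summable_mul_col ha v x).tsum_add (summable_mul_col ha w x)]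
        simp only [add_mul]
      map_smul' := fun r v => by
        ext x
        change ∑' n, (r * v n) * a n x = r * ∑' n, v n * a n x
        rw [← tsum_mul_left]
        simp only [mul_assoc] }
    (schurNorm 0 a).toReal (norm_vecMul_le ha)

theorem hasSum_act (ha : schurNorm 0 a < ∞) (v : ell 𝕜 p) (x : ℤ) :
    HasSum (fun n => v n * a n x) (act p ha v x) :=
  (summable_mul_col ha v x).hasSum

theorem norm_act_le (ha : schurNorm 0 a < ∞) (v : ell 𝕜 p) :
    ‖act p ha v‖ ≤ (schurNorm 0 a).toReal * ‖v‖ := norm_vecMul_le ha v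

theorem act_single (ha : schurNorm 0 a < ∞) (n x : ℤ) :
    act p ha (lp.single p n 1) x = a n x := by
  refine (hasSum_act ha _ x).unique ?_
  convert hasSum_single n fun m hm => ?_ using 1
  · simp
  · simp [Pi.single_eq_of_ne hm]

/-- Fubini's theorem for `∑ₙ ∑ₓ vₙ aₙₓ uₓ` with `u` summable. -/
theorem hasSum_act_mul (ha : schurNorm 0 a < ∞) (v : ell 𝕜 p) {u w : ℤ → 𝕜}
    (hu : ∑' x, ‖u x‖ₑ ≠ ∞) (hw : ∀ n, HasSum (fun x => a n x * u x) (w n)) :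
    HasSum (fun n => v n * w n) (∑' x, act p ha v x * u x) := by
  have hs : Summable fun q : ℤ × ℤ => v q.1 * a q.1 q.2 * u q.2 := by
    refine summable_of_tsum_enorm_ne_top ?_
    rw [ENNReal.tsum_prod (f := fun n x => ‖v n * a n x * u x‖ₑ), ENNReal.tsum_comm]
    refine ne_top_of_le_ne_top (b := ‖v‖ₑ * schurNorm 0 a * ∑' x, ‖u x‖ₑ)
      (ENNReal.mul_ne_top (ENNReal.mul_ne_top enorm_ne_top ha.ne) hu) ?_
    rw [← ENNReal.tsum_mul_left]
    refine ENNReal.tsum_le_tsum fun x => ?_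
    simp only [enorm_mul]
    rw [ENNReal.tsum_mul_right]
    gcongr
    refine (ENNReal.tsum_le_tsum fun n => mul_le_mul_left (enorm_apply_le v n) _).trans ?_
    rw [ENNReal.tsum_mul_left]
    gcongr
    exact col_le_schurNorm a x
  have h1 : HasSum (fun n => v n * w n) (∑' q : ℤ × ℤ, v q.1 * a q.1 q.2 * u q.2) :=
    hs.hasSum.prod_fiberwise fun n => by simpa only [mul_assoc] using (hw n).mul_left (v n)
  have h2 : HasSum (fun x => act p ha v x * u x) (∑' q : ℤ × ℤ, v q.1 * a q.1 q.2 * u q.2) :=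
    ((Equiv.prodComm ℤ ℤ).hasSum_iff.2 hs.hasSum).prod_fiberwise fun x =>
      (hasSum_act ha v x).mul_right (u x)
  rwa [h2.tsum_eq]

theorem act_act (ha : schurNorm 0 a < ∞) (hb : schurNorm 0 b < ∞) (hc : schurNorm 0 c < ∞)
    (h : ∀ n y, HasSum (fun x => a n x * b x y) (c n y)) (v : ell 𝕜 p) :
    act p hb (act p ha v) = act p hc v := by
  ext y
  refine HasSum.unique ?_ (hasSum_act hc v y)
  have := hasSum_act_mul ha v (ne_top_of_le_ne_top hb.ne (col_le_schurNorm b y)) fun n => h n y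
  rwa [(hasSum_act hb (act p ha v) y).tsum_eq] at this

end Action

/-! ### Gramians of localized frames -/

section Gramians

variable {𝕜 H : Type*} [RCLike 𝕜] [NormedAddCommGroup H] [InnerProductSpace 𝕜 H]
  [CompleteSpace H] {g : ℤ → H} (hg : IsFrame 𝕜 g)

theorem hasSum_frame_smul_dual (f : H) : HasSum (fun n => pair 𝕜 f (g n) • dual g hg n) f := by
  have hu := isUnit_frameOp g hg
  have h1 : ∀ f, Ring.inverse (frameOp g hg) (frameOp g hg f) = f := fun f =>
    congrArg (fun T : H →L[𝕜] H => T f) (Ring.inverse_mul_cancel _ hu)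
  have h := (hasSum_dual g hg (frameOp g hg f)).mapL (Ring.inverse (frameOp g hg))
  rw [h1] at h
  refine h.congr_fun fun n => ?_
  rw [map_smul, pair_dual, adjoint_inverse_frameOp, h1]
  rfl

omit [CompleteSpace H] in
theorem hasSum_pair_left {f : H} {c : ℤ → 𝕜} {x : ℤ → H} (h : HasSum (fun n => c n • x n) f)
    (v : H) : HasSum (fun n => c n * pair 𝕜 (x n) v) (pair 𝕜 f v) := by
  refine (h.mapL (innerSL 𝕜 v)).congr_fun fun n => ?_
  rw [map_smul, smul_eq_mul]
  rfl

theorem hasSum_pair_dual_mul_pair (f v : H) :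
    HasSum (fun n => pair 𝕜 f (dual g hg n) * pair 𝕜 (g n) v) (pair 𝕜 f v) :=
  hasSum_pair_left (hasSum_dual g hg f) v

theorem hasSum_pair_mul_pair_dual (f v : H) :
    HasSum (fun n => pair 𝕜 f (g n) * pair 𝕜 (dual g hg n) v) (pair 𝕜 f v) :=
  hasSum_pair_left (hasSum_frame_smul_dual hg f) v

omit [CompleteSpace H] in
theorem schurNorm_gram_swap (s : ℝ) (e f : ℤ → H) :
    schurNorm s (gram 𝕜 e f) = schurNorm s (gram 𝕜 f e) :=
  schurNorm_eq_of_norm_swap s fun _ _ => norm_pair_comm _ _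

theorem schurNorm_gram_dual_right {e : ℤ → H} (h : schurNorm 0 (gram 𝕜 e g) < ∞)
    (hd : schurNorm 0 (gram 𝕜 (dual g hg) (dual g hg)) < ∞) :
    schurNorm 0 (gram 𝕜 e (dual g hg)) < ∞ :=
  (schurNorm_zero_le_mul fun k l => hasSum_pair_mul_pair_dual hg (e k) (dual g hg l)).trans_lt
    (ENNReal.mul_lt_top h hd)

theorem schurNorm_gram_of_dual {e f : ℤ → H} (h : schurNorm 0 (gram 𝕜 e (dual g hg)) < ∞)
    (hd : schurNorm 0 (gram 𝕜 g f) < ∞) : schurNorm 0 (gram 𝕜 e f) < ∞ :=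
  (schurNorm_zero_le_mul fun k l => hasSum_pair_dual_mul_pair hg (e k) (f l)).trans_lt
    (ENNReal.mul_lt_top h hd)

theorem act_gram_act_gram {e f : ℤ → H} {p : ℝ≥0∞} [Fact (1 ≤ p)]
    (h1 : schurNorm 0 (gram 𝕜 e (dual g hg)) < ∞) (h2 : schurNorm 0 (gram 𝕜 g f) < ∞)
    (h3 : schurNorm 0 (gram 𝕜 e f) < ∞) (v : ell 𝕜 p) :
    act p h2 (act p h1 v) = act p h3 v :=
  act_act h1 h2 h3 (fun n y => hasSum_pair_dual_mul_pair hg (e n) (f y)) v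

end Gramians

/-! ### Atomic decompositions and their perturbation -/

section Decomposition

variable {𝕜 : Type*} [RCLike 𝕜] {p : ℝ≥0∞} [Fact (1 ≤ p)]
  {X Z : Type*} [NormedAddCommGroup X] [NormedSpace 𝕜 X]
  [AddCommGroup Z] [Module 𝕜 Z] [TopologicalSpace Z]

/-- The common form of the atomic decompositions of all the spaces `H^p`: the norm is measured by
the coefficient map `J`, and the series converges after the linear map `ι` into a space `Z`, which
is `X` itself for `p < ∞` and the space of functions on `H¹` for the weak-* topology. -/
def Decomposes (J : X →L[𝕜] ell 𝕜 p) (ι : X →ₗ[𝕜] Z) (z : ℤ → Z) (A B : ℝ) : Prop :=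
  0 < A ∧ 0 < B ∧ ∃ C : X →L[𝕜] ell 𝕜 p, ∀ f : X,
    A * ‖J f‖ ≤ ‖C f‖ ∧ ‖C f‖ ≤ B * ‖J f‖ ∧ HasSum (fun n => C f n • z n) (ι f)

/-- A synthesis operator `R` with a bounded right inverse of the form `K ∘ J` yields an atomic
decomposition. -/
theorem exists_decomposes {J : X →L[𝕜] ell 𝕜 p} {ι : X →ₗ[𝕜] Z} {z : ℤ → Z}
    (R : ell 𝕜 p →L[𝕜] X) (K : ell 𝕜 p →L[𝕜] ell 𝕜 p) (hRK : ∀ f, R (K (J f)) = f)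
    (hz : ∀ c : ell 𝕜 p, HasSum (fun n => c n • z n) (ι (R c))) :
    ∃ A B : ℝ, Decomposes J ι z A B := by
  refine ⟨(‖J ∘L R‖ + 1)⁻¹, ‖K‖ + 1, by positivity, by positivity, K ∘L J, fun f => ⟨?_, ?_, ?_⟩⟩
  · rw [inv_mul_le_iff₀ (by positivity)]
    calc ‖J f‖ = ‖(J ∘L R) (K (J f))‖ := by rw [ContinuousLinearMap.comp_apply, hRK]
      _ ≤ ‖J ∘L R‖ * ‖K (J f)‖ := ContinuousLinearMap.le_opNorm _ _
      _ ≤ (‖J ∘L R‖ + 1) * ‖K (J f)‖ := by gcongr; linarith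
  · calc ‖K (J f)‖ ≤ ‖K‖ * ‖J f‖ := ContinuousLinearMap.le_opNorm _ _
      _ ≤ (‖K‖ + 1) * ‖J f‖ := by gcongr; linarith
  · simpa only [ContinuousLinearMap.comp_apply, hRK] using hz (K (J f))

variable [ContinuousAdd Z]

/-- Perturbation of an atomic decomposition. With `C` the coefficient operator, the series with the
perturbed atoms sums to `(1 + R C) f`. Its inverse is `1 - R (1 + C R)⁻¹ C`, where `1 + C R` acts on
`ℓ^p` and is inverted by a Neumann series. -/
theorem Decomposes.perturb {J : X →L[𝕜] ell 𝕜 p} {ι : X →ₗ[𝕜] Z} {z z' : ℤ → Z} {A B ε : ℝ}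
    (h : Decomposes J ι z A B) (hε : 0 ≤ ε) (hεB : ε * B < 1) (R : ell 𝕜 p →L[𝕜] X)
    (hR : ∀ c, ‖J (R c)‖ ≤ ε * ‖c‖)
    (hz : ∀ c : ell 𝕜 p, HasSum (fun n => c n • (z' n - z n)) (ι (R c))) :
    Decomposes J ι z' (A * (1 + ε * B)⁻¹) (B * (1 - ε * B)⁻¹) := by
  obtain ⟨hA, hB, C, hC⟩ := h
  have hW : ‖C ∘L R‖ < 1 := by
    refine (ContinuousLinearMap.opNorm_le_bound _ (by positivity) fun c => ?_).trans_lt hεB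
    calc ‖C (R c)‖ ≤ B * ‖J (R c)‖ := (hC (R c)).2.1
      _ ≤ B * (ε * ‖c‖) := by gcongr; exact hR c
      _ = _ := by ring
  have hunit : IsUnit (1 + C ∘L R) := by
    have := (Units.oneSub (-(C ∘L R)) (by rwa [norm_neg])).isUnit
    rwa [Units.val_oneSub, sub_neg_eq_add] at this
  set V := Ring.inverse (1 + C ∘L R) with hV
  have hVc : ∀ c, V c + C (R (V c)) = c := fun c =>
    congrArg (fun T : ell 𝕜 p →L[𝕜] ell 𝕜 p => T c) (Ring.mul_inverse_cancel _ hunit)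
  have h1 : 0 < 1 - ε * B := by linarith
  have h2 : 0 < 1 + ε * B := by positivity
  refine ⟨by positivity, by positivity, V ∘L C, fun f => ?_⟩
  set f' := f - R (V (C f)) with hf'
  have hCf' : V (C f) = C f' := by
    rw [hf', map_sub]
    exact eq_sub_of_add_eq (hVc (C f))
  have hf : f = f' + R (C f') := by rw [← hCf', hf']; abel
  have hJR : ‖J (R (C f'))‖ ≤ ε * B * ‖J f'‖ := by
    refine (hR _).trans ?_
    rw [mul_assoc]
    gcongr
    exact (hC f').2.1
  have hJf : J f = J f' + J (R (C f')) := by conv_lhs => rw [hf, map_add]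
  rw [ContinuousLinearMap.comp_apply, hCf', hJf]
  refine ⟨?_, ?_, ?_⟩
  · refine le_trans ?_ (hC f').1
    rw [mul_assoc]
    refine mul_le_mul_of_nonneg_left ?_ hA.le
    rw [inv_mul_le_iff₀ h2]
    linarith [norm_add_le (J f') (J (R (C f')))]
  · refine (hC f').2.1.trans ?_
    rw [mul_assoc]
    refine mul_le_mul_of_nonneg_left ?_ hB.le
    rw [← div_eq_inv_mul, le_div_iff₀ h1]
    have := norm_sub_norm_le (J f') (-J (R (C f')))
    rw [norm_neg, sub_neg_eq_add] at this
    linarith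
  · have := ((hC f').2.2).add (hz (C f'))
    simp only [← smul_add, add_sub_cancel] at this
    rwa [← map_add, ← hf] at this

theorem decomposes_iff {J : X →ₗᵢ[𝕜] ell 𝕜 p} {x : ℤ → X} {A B : ℝ} :
    IsFrameAtomicDecomposition p 𝕜 x A B ↔
      Decomposes J.toContinuousLinearMap LinearMap.id x A B := by
  refine and_congr Iff.rfl (and_congr Iff.rfl ⟨?_, ?_⟩)
  · rintro ⟨xd, C, h⟩
    refine ⟨C, fun f => ?_⟩
    obtain ⟨h1, h2, h3, h4⟩ := h f
    have hJ : ‖J.toContinuousLinearMap f‖ = ‖f‖ := J.norm_map f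
    rw [hJ]
    exact ⟨h2, h3, h4.congr_fun fun n => by rw [h1 n]⟩
  · rintro ⟨C, h⟩
    refine ⟨fun n => (lp.evalCLM 𝕜 (fun _ : ℤ => 𝕜) p n) ∘L C, C, fun f => ?_⟩
    obtain ⟨h2, h3, h4⟩ := h f
    have hJ : ‖J.toContinuousLinearMap f‖ = ‖f‖ := J.norm_map f
    rw [hJ] at h2 h3
    exact ⟨fun n => rfl, h2, h3, h4⟩

end Decomposition

/-! ### Atomic decompositions in a space described by its coefficients -/

section Model

variable {𝕜 H : Type*} [RCLike 𝕜] [NormedAddCommGroup H] [InnerProductSpace 𝕜 H]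
  [CompleteSpace H] {G : ℤ → H} (hG : IsFrame 𝕜 G) {p : ℝ≥0∞} [Fact (1 ≤ p)]
  {X Z : Type*} [NormedAddCommGroup X] [NormedSpace 𝕜 X]
  [AddCommGroup Z] [Module 𝕜 Z] [TopologicalSpace Z]

/-- The synthesis operator of `F`, in coefficients with respect to `G`, is inverted from the right
by the analysis operator of the dual of `F`. -/
theorem exists_decomposes_of_localized {F : ℤ → H} (hF : IsFrame 𝕜 F)
    (hP : schurNorm 0 (gram 𝕜 G (dual G hG)) < ∞)
    (hFG : schurNorm 0 (gram 𝕜 F (dual G hG)) < ∞) (hGF : schurNorm 0 (gram 𝕜 G (dual F hF)) < ∞)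
    {J : X →L[𝕜] ell 𝕜 p} {D : ell 𝕜 p →L[𝕜] X} (hJD : ∀ c, J (D c) = act p hP c)
    (hDJ : ∀ f, D (J f) = f) {ι : X →ₗ[𝕜] Z} {z : ℤ → Z}
    (hz : ∀ c : ell 𝕜 p, HasSum (fun n => c n • z n) (ι (D (act p hFG c)))) :
    ∃ A B : ℝ, Decomposes J ι z A B := by
  refine exists_decomposes (D ∘L act p hFG) (act p hGF) (fun f => ?_) hz
  rw [ContinuousLinearMap.comp_apply, act_gram_act_gram hF hGF hFG hP, ← hJD, hDJ, hDJ]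

theorem Decomposes.perturb_of_schurNorm_le [ContinuousAdd Z] {e : ℤ → H}
    (hP : schurNorm 0 (gram 𝕜 G (dual G hG)) < ∞)
    (he : schurNorm 0 (gram 𝕜 e (dual G hG)) < ∞)
    {J : X →L[𝕜] ell 𝕜 p} {D : ell 𝕜 p →L[𝕜] X} (hJD : ∀ c, J (D c) = act p hP c)
    {ι : X →ₗ[𝕜] Z} {z z' : ℤ → Z} {A B ε : ℝ} (h : Decomposes J ι z A B) (hε : 0 ≤ ε)
    (hεB : ε * B < 1) (hle : schurNorm 0 (gram 𝕜 e (dual G hG)) ≤ ENNReal.ofReal ε)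
    (hz : ∀ c : ell 𝕜 p, HasSum (fun n => c n • (z' n - z n)) (ι (D (act p he c)))) :
    Decomposes J ι z' (A * (1 + ε * B)⁻¹) (B * (1 - ε * B)⁻¹) := by
  refine h.perturb hε hεB (D ∘L act p he) (fun c => ?_) hz
  rw [ContinuousLinearMap.comp_apply, hJD, act_gram_act_gram hG he hP he]
  refine (norm_act_le he c).trans ?_
  gcongr
  exact ENNReal.toReal_le_of_le_ofReal hε hle

/-- An isometry `J` whose range contains that of `T` factors `T`. -/
theorem exists_factor (J : X →ₗᵢ[𝕜] ell 𝕜 p) (T : ell 𝕜 p →L[𝕜] ell 𝕜 p)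
    (h : ∀ c, ∃ x, J x = T c) : ∃ D : ell 𝕜 p →L[𝕜] X, ∀ c, J (D c) = T c := by
  refine ⟨(J.equivRange.symm : _ →L[𝕜] X) ∘L
    T.codRestrict J.range (fun c => h c), fun c => ?_⟩
  have : J.equivRange (J.equivRange.symm (T.codRestrict J.range (fun c => h c) c)) =
      T.codRestrict J.range (fun c => h c) c := LinearIsometryEquiv.apply_symm_apply _ _
  exact congrArg Subtype.val this

/-- For `p < ∞`, the atoms in `X` that stand for the vectors `F n` are the elements with the same
coefficients. -/
theorem exists_isFrameAtomicDecomposition (hp : p ≠ ∞) {F : ℤ → H} (hF : IsFrame 𝕜 F)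
    (hP : schurNorm 0 (gram 𝕜 G (dual G hG)) < ∞)
    (hFG : schurNorm 0 (gram 𝕜 F (dual G hG)) < ∞) (hGF : schurNorm 0 (gram 𝕜 G (dual F hF)) < ∞)
    {J : X →ₗᵢ[𝕜] ell 𝕜 p} {D : ell 𝕜 p →L[𝕜] X} (hJD : ∀ c, J (D c) = act p hP c)
    (hDJ : ∀ f, D (J f) = f) :
    ∃ (x : ℤ → X) (A B : ℝ), (∀ n y, J (x n) y = pair 𝕜 (F n) (dual G hG y)) ∧
      IsFrameAtomicDecomposition p 𝕜 x A B := by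
  obtain ⟨A, B, h⟩ := exists_decomposes_of_localized hG hF hP hFG hGF
    (J := J.toContinuousLinearMap) hJD hDJ (ι := LinearMap.id)
    (fun c => hasSum_map_single hp (D ∘L act p hFG) c)
  refine ⟨_, A, B, fun n y => ?_, decomposes_iff.2 h⟩
  rw [ContinuousLinearMap.comp_apply, hJD, act_gram_act_gram hG hFG hP hFG, act_single]
  rfl

/-- The perturbed atoms are `x n` plus the synthesis of the `n`-th row of the matrix of `E - F`. -/
theorem exists_perturbed_isFrameAtomicDecomposition (hp : p ≠ ∞) {E F : ℤ → H}
    (hP : schurNorm 0 (gram 𝕜 G (dual G hG)) < ∞)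
    (he : schurNorm 0 (gram 𝕜 (E - F) (dual G hG)) < ∞)
    {J : X →ₗᵢ[𝕜] ell 𝕜 p} {D : ell 𝕜 p →L[𝕜] X} (hJD : ∀ c, J (D c) = act p hP c)
    {x : ℤ → X} (hx : ∀ n y, J (x n) y = pair 𝕜 (F n) (dual G hG y)) {A B ε : ℝ}
    (h : IsFrameAtomicDecomposition p 𝕜 x A B) (hε : 0 ≤ ε) (hεB : ε * B < 1)
    (hle : schurNorm 0 (gram 𝕜 (E - F) (dual G hG)) ≤ ENNReal.ofReal ε) :
    ∃ x' : ℤ → X, (∀ n y, J (x' n) y = pair 𝕜 (E n) (dual G hG y)) ∧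
      IsFrameAtomicDecomposition p 𝕜 x' (A * (1 + ε * B)⁻¹) (B * (1 - ε * B)⁻¹) := by
  refine ⟨fun n => x n + D (act p he (lp.single p n 1)), fun n y => ?_,
    (decomposes_iff (J := J)).2 ((decomposes_iff (J := J).1 h).perturb_of_schurNorm_le hG hP he hJD
      hε hεB hle fun c => ?_)⟩
  · rw [map_add, hJD, act_gram_act_gram hG he hP he]
    change J (x n) y + act p he (lp.single p n 1) y = _
    rw [act_single, hx]
    simp [gram, pair, inner_sub_right]
  · simp only [add_sub_cancel_left]
    exact hasSum_map_single hp (D ∘L act p he) c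

end Model

/-! ### The spaces `H^p` for `p < ∞` -/

section Spaces

variable {𝕜 H : Type*} [RCLike 𝕜] [NormedAddCommGroup H] [InnerProductSpace 𝕜 H]
  [CompleteSpace H] {g : ℤ → H} {hg : IsFrame 𝕜 g} {p : ℝ≥0∞} [Fact (1 ≤ p)]

omit [Fact (1 ≤ p)] in
theorem Hp.coeff_apply (f : Hp g hg p) (n : ℤ) :
    Hp.coeff f n = pair 𝕜 (Hp.toH f) (dual g hg n) := rfl

/-- The coefficient map as an isometry. -/
noncomputable def Hp.coeffIso : Hp g hg p →ₗᵢ[𝕜] ell 𝕜 p := ⟨Hp.coeff, fun _ => rfl⟩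

theorem Hp.coeffIso_apply (f : Hp g hg p) (n : ℤ) :
    Hp.coeffIso f n = pair 𝕜 (Hp.toH f) (dual g hg n) := rfl

omit [Fact (1 ≤ p)] in
theorem Hp.toH_eq_iff (f : Hp g hg p) (e : H) :
    Hp.toH f = e ↔ ∀ y, Hp.coeff f y = pair 𝕜 e (dual g hg y) := by
  refine ⟨fun h y => by rw [Hp.coeff_apply, h], fun h => ?_⟩
  refine sub_eq_zero.1 (eq_zero_of_dual g hg _ fun n => ?_)
  have := h n
  rw [Hp.coeff_apply] at this
  simp only [pair] at this ⊢
  rw [inner_sub_right, this, sub_self]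

theorem act_coeff (hP : schurNorm 0 (gram 𝕜 g (dual g hg)) < ∞) (f : Hp g hg p) :
    act p hP (Hp.coeffIso f) = Hp.coeffIso f := by
  ext y
  exact (hasSum_act hP _ y).unique (hasSum_pair_dual_mul_pair hg (Hp.toH f) (dual g hg y))

/-- For `p ≤ 2` the synthesis operator of the frame on `ℓ^p ⊆ ℓ²` takes values in `H^p`. -/
theorem exists_coeff_eq_act (hp : p ≤ 2) (hP : schurNorm 0 (gram 𝕜 g (dual g hg)) < ∞)
    (c : ell 𝕜 p) : ∃ f : Hp g hg p, Hp.coeffIso f = act p hP c := by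
  set c2 : ell 𝕜 2 := ⟨c, (lp.memℓp c).of_exponent_ge hp⟩ with hc2
  have h := hasSum_map_single (by simp) (ContinuousLinearMap.adjoint (analysisOp g hg)) c2
  simp only [adjoint_analysisOp_single, one_smul] at h
  have hy : ∀ y, pair 𝕜 (ContinuousLinearMap.adjoint (analysisOp g hg) c2) (dual g hg y) =
      act p hP c y := fun y => (hasSum_pair_left h (dual g hg y)).unique (hasSum_act hP c y)
  refine ⟨⟨ContinuousLinearMap.adjoint (analysisOp g hg) c2, ?_⟩, ?_⟩
  · change Memℓp _ p
    simp only [hy]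
    exact lp.memℓp (act p hP c)
  · ext y
    exact hy y

theorem exists_synthesis_Hp (hp : p ≤ 2) (hP : schurNorm 0 (gram 𝕜 g (dual g hg)) < ∞) :
    ∃ D : ell 𝕜 p →L[𝕜] Hp g hg p, (∀ c, Hp.coeffIso (D c) = act p hP c) ∧
      ∀ f, D (Hp.coeffIso f) = f := by
  obtain ⟨D, hD⟩ := exists_factor (Hp.coeffIso (g := g) (hg := hg)) (act p hP)
    (exists_coeff_eq_act hp hP)
  exact ⟨D, hD, fun f => Hp.coeffIso.injective (by rw [hD, act_coeff])⟩

-- instance search for the completion is slow without these two shortcuts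
noncomputable instance : NormedAddCommGroup (HpCompl g hg p) :=
  UniformSpace.Completion.instNormedAddCommGroup (H0 g hg p)

noncomputable instance : NormedSpace 𝕜 (HpCompl g hg p) :=
  UniformSpace.Completion.instNormedSpace 𝕜 (H0 g hg p)

/-- The coefficient map on the completion `H^p`, `2 < p < ∞`. -/
noncomputable def complCoeff : HpCompl g hg p →ₗᵢ[𝕜] ell 𝕜 p where
  toLinearMap := (((Hp.coeffIso (g := g) (hg := hg) (p := p)).toContinuousLinearMap ∘L
    (H0 g hg p).subtypeL).extend (UniformSpace.Completion.toComplL (𝕜 := 𝕜) (E := H0 g hg p))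
      ).toLinearMap
  norm_map' := fun x => by
    induction x using UniformSpace.Completion.induction_on with
    | hp =>
      exact isClosed_eq (continuous_norm.comp (ContinuousLinearMap.continuous _)) continuous_norm
    | ih u =>
      have := ContinuousLinearMap.extend_eq ((Hp.coeffIso (g := g) (hg := hg)
        (p := p)).toContinuousLinearMap ∘L (H0 g hg p).subtypeL)
        (e := UniformSpace.Completion.toComplL (𝕜 := 𝕜) (E := H0 g hg p))
        UniformSpace.Completion.denseRange_coe (UniformSpace.Completion.isUniformInducing_coe _) u
      rw [UniformSpace.Completion.norm_coe]
      exact (congrArg norm this).trans (Hp.coeffIso.norm_map _)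

theorem complCoeff_coe (u : H0 g hg p) :
    complCoeff (u : HpCompl g hg p) = Hp.coeffIso (u : Hp g hg p) :=
  ContinuousLinearMap.extend_eq ((Hp.coeffIso (g := g) (hg := hg)
    (p := p)).toContinuousLinearMap ∘L (H0 g hg p).subtypeL)
    (e := UniformSpace.Completion.toComplL (𝕜 := 𝕜) (E := H0 g hg p))
    UniformSpace.Completion.denseRange_coe (UniformSpace.Completion.isUniformInducing_coe _) u

theorem act_complCoeff (hP : schurNorm 0 (gram 𝕜 g (dual g hg)) < ∞) (x : HpCompl g hg p) :
    act p hP (complCoeff x) = complCoeff x := by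
  induction x using UniformSpace.Completion.induction_on with
  | hp =>
    exact isClosed_eq ((act p hP).continuous.comp complCoeff.continuous) complCoeff.continuous
  | ih u => rw [complCoeff_coe, act_coeff]

/-- The frame vector `g n` as an element of `H₀`, for `2 ≤ p`. -/
def frameVec (hp : 2 ≤ p) (n : ℤ) : H0 g hg p :=
  ⟨⟨g n, dual_memℓp g hg (g n) hp⟩, Submodule.subset_span ⟨n, rfl⟩⟩

theorem complCoeff_frameVec (hp : 2 ≤ p) (hP : schurNorm 0 (gram 𝕜 g (dual g hg)) < ∞) (n : ℤ) :
    complCoeff ((frameVec hp n : H0 g hg p) : HpCompl g hg p) = act p hP (lp.single p n 1) := by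
  rw [complCoeff_coe]
  ext y
  rw [act_single]
  rfl

theorem exists_synthesis_compl (hp : 2 ≤ p) (hp' : p ≠ ∞)
    (hP : schurNorm 0 (gram 𝕜 g (dual g hg)) < ∞) :
    ∃ D : ell 𝕜 p →L[𝕜] HpCompl g hg p, (∀ c, complCoeff (D c) = act p hP c) ∧
      ∀ x, D (complCoeff x) = x := by
  obtain ⟨D, hD⟩ := exists_factor (complCoeff (g := g) (hg := hg) (p := p)) (act p hP) fun c => by
    have hcl : IsClosed (Set.range (complCoeff (g := g) (hg := hg) (p := p))) :=
      complCoeff.isometry.isClosedEmbedding.isClosed_range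
    refine hcl.mem_of_tendsto (hasSum_map_single hp' (act p hP) c) (.of_forall fun s => ?_)
    refine ⟨∑ n ∈ s, c n • ((frameVec hp n : H0 g hg p) : HpCompl g hg p), ?_⟩
    rw [map_sum]
    exact Finset.sum_congr rfl fun n _ => by rw [map_smul, complCoeff_frameVec hp hP]
  exact ⟨D, hD, fun x => complCoeff.injective (by rw [hD, act_complCoeff])⟩

/-- The image of `f ∈ H` in the completion is the element with the same coefficients. -/
theorem represents_iff (hp : 2 ≤ p) (hp' : p ≠ ∞) (hP : schurNorm 0 (gram 𝕜 g (dual g hg)) < ∞)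
    (f : H) (x : HpCompl g hg p) :
    Represents g hg p f x ↔ ∀ y, complCoeff x y = pair 𝕜 f (dual g hg y) := by
  constructor
  · rintro ⟨u, hu, hx⟩ y
    have h1 : Tendsto (fun k => complCoeff (u k : HpCompl g hg p) y) atTop (𝓝 (complCoeff x y)) :=
      (((lp.evalCLM 𝕜 (fun _ : ℤ => 𝕜) p y).continuous.comp complCoeff.continuous).tendsto x).comp
        hx
    have h2 : Tendsto (fun k => pair 𝕜 (Hp.toH (u k : Hp g hg p)) (dual g hg y)) atTop
        (𝓝 (pair 𝕜 f (dual g hg y))) :=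
      ((innerSL 𝕜 (dual g hg y)).continuous.tendsto f).comp hu
    simp only [complCoeff_coe] at h1
    exact tendsto_nhds_unique h1 h2
  · intro h
    obtain ⟨D, hD, hDx⟩ := exists_synthesis_compl hp hp' hP
    obtain ⟨s, hs⟩ := exists_seq_tendsto (atTop : Filter (Finset ℤ))
    refine ⟨fun k => ∑ n ∈ s k, pair 𝕜 f (dual g hg n) • frameVec hp n, ?_, ?_⟩
    · have h1 := (hasSum_dual g hg f).comp hs
      refine h1.congr fun k => ?_
      rw [AddSubmonoidClass.coe_finsetSum, map_sum]
      rfl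
    · have h1 := hasSum_map_single hp' D (complCoeff x)
      rw [hDx] at h1
      refine (h1.comp hs).congr fun k => ?_
      have hDn : ∀ n, D (lp.single p n 1) =
          ((frameVec hp n : H0 g hg p) : HpCompl g hg p) := fun n =>
        complCoeff.injective (by rw [hD, complCoeff_frameVec hp hP])
      simp only [Function.comp_apply, hDn, h]
      change _ = UniformSpace.Completion.toComplL (𝕜 := 𝕜) (E := H0 g hg p) _
      rw [map_sum]
      exact Finset.sum_congr rfl fun n _ => (UniformSpace.Completion.coe_smul _ _).symm

end Spaces

/-! ### The space `H^∞` -/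

section Infinity

variable {𝕜 H : Type*} [RCLike 𝕜] [NormedAddCommGroup H] [InnerProductSpace 𝕜 H]
  [CompleteSpace H] {g : ℤ → H} {hg : IsFrame 𝕜 g}

theorem memℓp_row (p : ℝ≥0∞) [Fact (1 ≤ p)] {a : Matrix ℤ ℤ 𝕜} (ha : schurNorm 0 a < ∞) (n : ℤ) :
    Memℓp (fun y => a n y) p := by
  have := lp.memℓp (act p ha (lp.single p n 1))
  rwa [show ((act p ha (lp.single p n 1) : ell 𝕜 p) : ℤ → 𝕜) = fun y => a n y from
    funext fun y => act_single ha n y] at this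

/-- The dual frame vector as an element of `H¹`. -/
noncomputable def dualVec (hd : schurNorm 0 (gram 𝕜 (dual g hg) (dual g hg)) < ∞) (n : ℤ) :
    Hp g hg 1 :=
  ⟨dual g hg n, memℓp_row 1 hd n⟩

theorem coeffIso_dualVec (hd : schurNorm 0 (gram 𝕜 (dual g hg) (dual g hg)) < ∞) (n : ℤ) :
    Hp.coeffIso (dualVec hd n) = act 1 hd (lp.single 1 n 1) := by
  ext y
  rw [act_single]
  rfl

/-- The expansion `h = ∑ₙ ⟨h, gₙ⟩ g̃ₙ` converges in `H¹`. -/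
theorem hasSum_dualVec (hgg : schurNorm 0 (gram 𝕜 g g) < ∞)
    (hd : schurNorm 0 (gram 𝕜 (dual g hg) (dual g hg)) < ∞) (h : Hp g hg 1) :
    HasSum (fun n => pair 𝕜 (Hp.toH h) (g n) • dualVec hd n) h := by
  have hP := schurNorm_gram_dual_right hg hgg hd
  obtain ⟨D, hD, hDc⟩ := exists_synthesis_Hp (g := g) (hg := hg) (p := 1) (by norm_num) hP
  set c : ell 𝕜 1 := act 1 hgg (Hp.coeffIso h) with hc
  have hcn : ∀ n, c n = pair 𝕜 (Hp.toH h) (g n) := fun n =>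
    (hasSum_act hgg _ n).unique (hasSum_pair_dual_mul_pair hg (Hp.toH h) (g n))
  have hsum := hasSum_map_single (by simp) (D ∘L act 1 hd) c
  have h1 : (D ∘L act 1 hd) c = h := by
    rw [ContinuousLinearMap.comp_apply, hc, act_act hgg hd hP
      (fun n y => hasSum_pair_mul_pair_dual hg (g n) (dual g hg y)), act_coeff, hDc]
  have h2 : ∀ n, (D ∘L act 1 hd) (lp.single 1 n 1) = dualVec hd n := fun n => by
    rw [ContinuousLinearMap.comp_apply, ← coeffIso_dualVec, hDc]
  rw [h1] at hsum
  simpa only [h2, hcn] using hsum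

theorem norm_dualVec_le (hd : schurNorm 0 (gram 𝕜 (dual g hg) (dual g hg)) < ∞) (n : ℤ) :
    ‖dualVec hd n‖ ≤ (schurNorm 0 (gram 𝕜 (dual g hg) (dual g hg))).toReal := by
  rw [← Hp.coeffIso.norm_map, coeffIso_dualVec]
  refine (norm_act_le hd _).trans ?_
  rw [lp.norm_single zero_lt_one]
  simp

/-- The coefficient map `φ ↦ (φ(g̃ₙ))ₙ` on `H^∞`. -/
noncomputable def infCoeff (hd : schurNorm 0 (gram 𝕜 (dual g hg) (dual g hg)) < ∞) :
    HInf g hg →L[𝕜] ell 𝕜 ∞ :=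
  have hb : ∀ (φ : HInf g hg) n, ‖φ (dualVec hd n)‖ ≤
      (schurNorm 0 (gram 𝕜 (dual g hg) (dual g hg))).toReal * ‖φ‖ := fun φ n => by
    rw [mul_comm]
    exact (φ.le_opNorm _).trans (by gcongr; exact norm_dualVec_le hd n)
  LinearMap.mkContinuous
    { toFun := fun φ => ⟨fun n => φ (dualVec hd n), memℓp_infty ⟨_, by
        rintro _ ⟨n, rfl⟩
        exact hb φ n⟩⟩
      map_add' := fun _ _ => rfl
      map_smul' := fun _ _ => rfl }
    (schurNorm 0 (gram 𝕜 (dual g hg) (dual g hg))).toReal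
    (fun φ => lp.norm_le_of_forall_le (by positivity) (hb φ))

theorem infCoeff_apply (hd : schurNorm 0 (gram 𝕜 (dual g hg) (dual g hg)) < ∞) (φ : HInf g hg)
    (n : ℤ) : infCoeff hd φ n = φ (dualVec hd n) := rfl

theorem HInf.enorm_eq (hd : schurNorm 0 (gram 𝕜 (dual g hg) (dual g hg)) < ∞) (φ : HInf g hg) :
    HInf.enorm g hg φ = ‖infCoeff hd φ‖ₑ := by
  refine le_antisymm (iSup₂_le fun n _ => enorm_apply_le (infCoeff hd φ) n) ?_
  by_cases htop : HInf.enorm g hg φ = ∞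
  · rw [htop]; exact le_top
  rw [← ofReal_norm]
  refine ENNReal.ofReal_le_of_le_toReal (lp.norm_le_of_forall_le ENNReal.toReal_nonneg fun n => ?_)
  rw [← toReal_enorm]
  refine ENNReal.toReal_mono htop ?_
  exact le_iSup₂_of_le (f := fun n (h : dual g hg n ∈ coeffSubspace g hg 1) =>
    ‖φ (⟨dual g hg n, h⟩ : Hp g hg 1)‖ₑ) n (memℓp_row 1 hd n) le_rfl

theorem tsum_enorm_eq (c : ell 𝕜 1) : ∑' n, ‖c n‖ₑ = ‖c‖ₑ := by
  have := enorm_rpow_eq_tsum (p := 1) (by simp) c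
  simpa using this.symm

omit [CompleteSpace H] in
theorem enorm_pair_comm (f h : H) : ‖pair 𝕜 f h‖ₑ = ‖pair 𝕜 h f‖ₑ :=
  enorm_eq_iff_norm_eq.2 (norm_pair_comm f h)

/-- The pairings of `h ∈ H¹` with the frame vectors are summable. -/
theorem tsum_enorm_pair_le (hgg : schurNorm 0 (gram 𝕜 g g) < ∞) (h : Hp g hg 1) :
    ∑' n, ‖pair 𝕜 (g n) (Hp.toH h)‖ₑ ≤
      ENNReal.ofReal ((schurNorm 0 (gram 𝕜 g g)).toReal * ‖h‖) := by
  have hcn : ∀ n, act 1 hgg (Hp.coeffIso h) n = pair 𝕜 (Hp.toH h) (g n) := fun n =>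
    (hasSum_act hgg _ n).unique (hasSum_pair_dual_mul_pair hg (Hp.toH h) (g n))
  have h1 := tsum_enorm_eq (act 1 hgg (Hp.coeffIso h))
  simp only [hcn] at h1
  rw [tsum_congr fun n => enorm_pair_comm (g n) (Hp.toH h), h1, ← ofReal_norm]
  refine ENNReal.ofReal_le_ofReal ((norm_act_le hgg _).trans_eq ?_)
  rw [Hp.coeffIso.norm_map]

theorem summable_norm_infSynth (hgg : schurNorm 0 (gram 𝕜 g g) < ∞) (c : ell 𝕜 ∞)
    (h : Hp g hg 1) : Summable (fun n => c n * pair 𝕜 (g n) (Hp.toH h)) ∧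
      ‖∑' n, c n * pair 𝕜 (g n) (Hp.toH h)‖ ≤
        (schurNorm 0 (gram 𝕜 g g)).toReal * ‖c‖ * ‖h‖ := by
  have hle : ∑' n, ‖c n * pair 𝕜 (g n) (Hp.toH h)‖ₑ ≤
      ENNReal.ofReal ((schurNorm 0 (gram 𝕜 g g)).toReal * ‖c‖ * ‖h‖) := by
    calc _ ≤ ∑' n, ‖c‖ₑ * ‖pair 𝕜 (g n) (Hp.toH h)‖ₑ := ENNReal.tsum_le_tsum fun n => by
          rw [enorm_mul]; gcongr; exact enorm_apply_le c n
      _ ≤ ‖c‖ₑ * ENNReal.ofReal ((schurNorm 0 (gram 𝕜 g g)).toReal * ‖h‖) := by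
          rw [ENNReal.tsum_mul_left]; gcongr; exact tsum_enorm_pair_le hgg h
      _ = _ := by
          rw [← ofReal_norm, ← ENNReal.ofReal_mul (by positivity)]
          congr 1
          ring
  refine ⟨summable_of_tsum_enorm_ne_top (ne_top_of_le_ne_top ENNReal.ofReal_ne_top hle), ?_⟩
  rw [← toReal_enorm]
  exact ENNReal.toReal_le_of_le_ofReal (by positivity) (enorm_tsum_le_tsum_enorm.trans hle)

/-- The synthesis operator `c ↦ (h ↦ ∑ₙ cₙ ⟨gₙ, h⟩)` from `ℓ^∞` to `H^∞`. -/
noncomputable def infSynth (hgg : schurNorm 0 (gram 𝕜 g g) < ∞) : ell 𝕜 ∞ →L[𝕜] HInf g hg :=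
  LinearMap.mkContinuous₂
    (LinearMap.mk₂'ₛₗ (RingHom.id 𝕜) (starRingEnd 𝕜)
      (fun (c : ell 𝕜 ∞) (h : Hp g hg 1) => ∑' n, c n * pair 𝕜 (g n) (Hp.toH h))
      (fun c d h => by
        rw [← (summable_norm_infSynth hgg c h).1.tsum_add (summable_norm_infSynth hgg d h).1]
        exact tsum_congr fun n => add_mul _ _ _)
      (fun r c h => by
        rw [RingHom.id_apply, smul_eq_mul, ← tsum_mul_left]
        exact tsum_congr fun n => mul_assoc _ _ _)
      (fun c h k => by
        rw [← (summable_norm_infSynth hgg c h).1.tsum_add (summable_norm_infSynth hgg c k).1]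
        exact tsum_congr fun n => by rw [map_add, pair, inner_add_left, mul_add]; rfl)
      (fun r c h => by
        rw [smul_eq_mul, ← tsum_mul_left]
        exact tsum_congr fun n => by rw [map_smul, pair, inner_smul_left, mul_left_comm]; rfl))
    (schurNorm 0 (gram 𝕜 g g)).toReal (fun c h => (summable_norm_infSynth hgg c h).2)

theorem infSynth_apply (hgg : schurNorm 0 (gram 𝕜 g g) < ∞) (c : ell 𝕜 ∞) (h : Hp g hg 1) :
    infSynth hgg c h = ∑' n, c n * pair 𝕜 (g n) (Hp.toH h) := rfl

theorem infCoeff_infSynth (hgg : schurNorm 0 (gram 𝕜 g g) < ∞)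
    (hd : schurNorm 0 (gram 𝕜 (dual g hg) (dual g hg)) < ∞)
    (hP : schurNorm 0 (gram 𝕜 g (dual g hg)) < ∞) (c : ell 𝕜 ∞) :
    infCoeff hd (infSynth hgg c) = act ∞ hP c := by
  ext y
  exact (hasSum_act hP c y).tsum_eq.symm ▸ rfl

theorem infSynth_infCoeff (hgg : schurNorm 0 (gram 𝕜 g g) < ∞)
    (hd : schurNorm 0 (gram 𝕜 (dual g hg) (dual g hg)) < ∞) (φ : HInf g hg) :
    infSynth hgg (infCoeff hd φ) = φ := by
  ext h
  have h1 := (hasSum_dualVec hgg hd h).mapL φ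
  rw [infSynth_apply, ← h1.tsum_eq]
  refine tsum_congr fun n => ?_
  rw [ContinuousLinearMap.map_smulₛₗ, smul_eq_mul, mul_comm, infCoeff_apply]
  congr 1
  exact (inner_conj_symm _ _).symm

/-- `H^∞` as a space of functions on `H¹` with the topology of pointwise convergence, which is the
weak-* topology. -/
noncomputable def infFun : HInf g hg →ₗ[𝕜] (Hp g hg 1 → 𝕜) where
  toFun := fun φ h => φ h
  map_add' := fun _ _ => rfl
  map_smul' := fun _ _ => rfl

/-- A vector of `H` as a conjugate-linear functional on `H¹`, without its continuity. -/
def pairFun (e : H) : Hp g hg 1 → 𝕜 := fun h => pair 𝕜 e (Hp.toH h)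

theorem hasSum_infSynth_act (hgg : schurNorm 0 (gram 𝕜 g g) < ∞) {e : ℤ → H}
    (he : schurNorm 0 (gram 𝕜 e (dual g hg)) < ∞) (c : ell 𝕜 ∞) :
    HasSum (fun n => c n • (pairFun (e n) : Hp g hg 1 → 𝕜))
      (infFun (infSynth hgg (act ∞ he c))) :=
  Pi.hasSum.2 fun h => hasSum_act_mul he c
    (ne_top_of_le_ne_top ENNReal.ofReal_ne_top (tsum_enorm_pair_le hgg h))
    fun n => hasSum_pair_dual_mul_pair hg (e n) (Hp.toH h)

theorem infSynth_act_single (hgg : schurNorm 0 (gram 𝕜 g g) < ∞) {e : ℤ → H}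
    (he : schurNorm 0 (gram 𝕜 e (dual g hg)) < ∞) (n : ℤ) (h : Hp g hg 1) :
    infSynth hgg (act ∞ he (lp.single ∞ n 1)) h = pair 𝕜 (e n) (Hp.toH h) := by
  have h1 := Pi.hasSum.1 (hasSum_infSynth_act hgg he (lp.single ∞ n 1)) h
  refine h1.unique ?_
  convert hasSum_single n fun m hm => ?_ using 1
  · simp [pairFun]
  · simp [Pi.single_eq_of_ne hm]

theorem decomposesInf_iff (hd : schurNorm 0 (gram 𝕜 (dual g hg) (dual g hg)) < ∞)
    {x : ℤ → HInf g hg} {A B : ℝ} :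
    IsFrameAtomicDecompositionInf g hg x A B ↔
      Decomposes (infCoeff hd) infFun (fun n => infFun (x n)) A B := by
  refine and_congr_right fun hA => and_congr_right fun hB => ?_
  have hofReal : ∀ (φ : HInf g hg) {r : ℝ}, 0 < r → ENNReal.ofReal r * HInf.enorm g hg φ =
      ENNReal.ofReal (r * ‖infCoeff hd φ‖) := fun φ r hr => by
    rw [HInf.enorm_eq hd, ENNReal.ofReal_mul hr.le, ofReal_norm]
  constructor
  · rintro ⟨xd, C, h⟩
    refine ⟨C, fun φ => ?_⟩
    obtain ⟨h1, h2, h3, h4⟩ := h φ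
    rw [hofReal φ hA, ← ofReal_norm, ENNReal.ofReal_le_ofReal_iff (norm_nonneg _)] at h2
    rw [hofReal φ hB, ← ofReal_norm, ENNReal.ofReal_le_ofReal_iff (by positivity)] at h3
    refine ⟨h2, h3, Pi.hasSum.2 fun k => (h4 k).congr_fun fun n => ?_⟩
    rw [← h1]
    rfl
  · rintro ⟨C, h⟩
    refine ⟨fun n => (lp.evalCLM 𝕜 (fun _ : ℤ => 𝕜) ∞ n) ∘L C, C, fun φ => ?_⟩
    obtain ⟨h2, h3, h4⟩ := h φ
    refine ⟨fun n => rfl, ?_, ?_, fun k => Pi.hasSum.1 h4 k⟩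
    · rw [hofReal φ hA, ← ofReal_norm]
      exact ENNReal.ofReal_le_ofReal h2
    · rw [hofReal φ hB, ← ofReal_norm]
      exact ENNReal.ofReal_le_ofReal h3

end Infinity

/-! ### Localized frames and their perturbations -/

section Final

variable {𝕜 H : Type*} [RCLike 𝕜] [NormedAddCommGroup H] [InnerProductSpace 𝕜 H]
  [CompleteSpace H] {G : ℤ → H} {hG : IsFrame 𝕜 G}

theorem exists_isHpFrame (p : ℝ≥0∞) [Fact (1 ≤ p)] {F : ℤ → H} (hF : IsFrame 𝕜 F)
    (hGG : schurNorm 0 (gram 𝕜 G G) < ∞)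
    (hd : schurNorm 0 (gram 𝕜 (dual G hG) (dual G hG)) < ∞)
    (hFG : schurNorm 0 (gram 𝕜 F (dual G hG)) < ∞)
    (hGF : schurNorm 0 (gram 𝕜 G (dual F hF)) < ∞) :
    ∃ A B : ℝ, IsHpFrame G hG p F A B := by
  have hP := schurNorm_gram_dual_right hG hGG hd
  rcases le_or_gt p 2 with h2 | h2
  · obtain ⟨D, hD, hDc⟩ := exists_synthesis_Hp (g := G) (hg := hG) h2 hP
    have hp : p ≠ ∞ := ne_top_of_le_ne_top (by simp) h2
    obtain ⟨x, A, B, hx, h⟩ := exists_isFrameAtomicDecomposition hG hp hF hP hFG hGF hD hDc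
    exact ⟨A, B, fun _ => ⟨x, fun n => (Hp.toH_eq_iff _ _).2 (hx n), h⟩,
      fun h => absurd h h2.not_gt, fun h => absurd h hp⟩
  rcases eq_or_ne p ∞ with rfl | hp
  · obtain ⟨A, B, h⟩ := exists_decomposes_of_localized hG hF hP hFG hGF
      (infCoeff_infSynth hGG hd hP) (infSynth_infCoeff hGG hd) (ι := infFun)
      (hasSum_infSynth_act hGG hFG)
    refine ⟨A, B, fun h => absurd h h2.not_ge, fun _ h => absurd rfl h, fun _ =>
      ⟨fun n => infSynth hGG (act ∞ hFG (lp.single ∞ n 1)),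
        fun n k => infSynth_act_single hGG hFG n k, (decomposesInf_iff hd).2 ?_⟩⟩
    convert h using 2 with n
    exact funext fun k => infSynth_act_single hGG hFG n k
  · obtain ⟨D, hD, hDc⟩ := exists_synthesis_compl (g := G) (hg := hG) h2.le hp hP
    obtain ⟨x, A, B, hx, h⟩ := exists_isFrameAtomicDecomposition hG hp hF hP hFG hGF hD hDc
    exact ⟨A, B, fun h => absurd h h2.not_ge,
      fun _ _ => ⟨x, fun n => (represents_iff h2.le hp hP _ _).2 (hx n), h⟩,
      fun h => absurd h hp⟩

theorem IsHpFrame.perturb {p : ℝ≥0∞} [Fact (1 ≤ p)] {E F : ℤ → H}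
    (hGG : schurNorm 0 (gram 𝕜 G G) < ∞)
    (hd : schurNorm 0 (gram 𝕜 (dual G hG) (dual G hG)) < ∞)
    (hE : schurNorm 0 (gram 𝕜 E (dual G hG)) < ∞) {A B ε : ℝ} (h : IsHpFrame G hG p F A B)
    (hε : 0 ≤ ε) (hεB : ε * B < 1)
    (hle : schurNorm 0 (gram 𝕜 (E - F) (dual G hG)) ≤ ENNReal.ofReal ε) :
    IsHpFrame G hG p E (A * (1 + ε * B)⁻¹) (B * (1 - ε * B)⁻¹) := by
  have hP := schurNorm_gram_dual_right hG hGG hd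
  have he := hle.trans_lt ENNReal.ofReal_lt_top
  obtain ⟨h1, h2, h3⟩ := h
  refine ⟨fun hp => ?_, fun hp hp' => ?_, fun hp => ?_⟩
  · obtain ⟨x, hx, hdec⟩ := h1 hp
    obtain ⟨D, hD, hDc⟩ := exists_synthesis_Hp (g := G) (hg := hG) hp hP
    obtain ⟨x', hx', hdec'⟩ := exists_perturbed_isFrameAtomicDecomposition hG
      (ne_top_of_le_ne_top (by simp) hp) hP he hD
      (fun n => (Hp.toH_eq_iff (x n) (F n)).1 (hx n)) hdec hε hεB hle
    exact ⟨x', fun n => (Hp.toH_eq_iff _ _).2 (hx' n), hdec'⟩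
  · obtain ⟨x, hx, hdec⟩ := h2 hp hp'
    obtain ⟨D, hD, hDc⟩ := exists_synthesis_compl (g := G) (hg := hG) hp.le hp' hP
    obtain ⟨x', hx', hdec'⟩ := exists_perturbed_isFrameAtomicDecomposition hG hp' hP he hD
      (fun n => (represents_iff hp.le hp' hP (F n) (x n)).1 (hx n)) hdec hε hεB hle
    exact ⟨x', fun n => (represents_iff hp.le hp' hP _ _).2 (hx' n), hdec'⟩
  · subst hp
    obtain ⟨x, hx, hdec⟩ := h3 rfl
    refine ⟨fun n => infSynth hGG (act ∞ hE (lp.single ∞ n 1)),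
      fun n k => infSynth_act_single hGG hE n k, (decomposesInf_iff hd).2 ?_⟩
    refine ((decomposesInf_iff hd).1 hdec).perturb_of_schurNorm_le hG hP he
      (infCoeff_infSynth hGG hd hP) hε hεB hle fun c => ?_
    refine (hasSum_infSynth_act hGG he c).congr_fun fun n => ?_
    congr 1
    refine funext fun k => ?_
    change infSynth hGG (act ∞ hE (lp.single ∞ n 1)) k - x n k = pair 𝕜 (E n - F n) (Hp.toH k)
    rw [infSynth_act_single, hx, pair, pair, pair, inner_sub_right]

/-- A sequence which is localized with respect to `G` and is an atomic decomposition of `H²` is a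
frame: the upper bound is Schur's test, and `‖f‖² = ∑ₙ cₙ ⟨eₙ, f⟩` with `‖c‖ ≲ ‖f‖` gives the lower
bound. -/
theorem isFrame_of_isHpFrame_two {E : ℤ → H} (hE : schurNorm 0 (gram 𝕜 E (dual G hG)) < ∞)
    {A B : ℝ} (h : IsHpFrame G hG 2 E A B) : IsFrame 𝕜 E := by
  have hE' : schurNorm 0 (gram 𝕜 (dual G hG) E) < ∞ :=
    (schurNorm_gram_swap 0 _ _).trans_lt hE
  -- the analysis operator of `E`
  set W : H →L[𝕜] ell 𝕜 2 := act 2 hE' ∘L analysisOp G hG with hW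
  have hWn : ∀ f n, W f n = pair 𝕜 f (E n) := fun f n =>
    (hasSum_act hE' (analysisOp G hG f) n).unique (hasSum_pair_mul_pair_dual hG f (E n))
  have hWsq : ∀ f, HasSum (fun n => ‖pair 𝕜 f (E n)‖ ^ 2) (‖W f‖ ^ 2) := fun f => by
    simpa [hWn] using lp.hasSum_norm (p := 2) (by norm_num) (W f)
  obtain ⟨x, hx, -, hB, xd, C, hC⟩ := h.1 le_rfl
  set K : H →L[𝕜] ell 𝕜 2 := analysisOp G hG ∘L Ring.inverse (frameOp G hG) with hK
  have hKn : ∀ f n, K f n = pair 𝕜 f (dual G hG n) := fun f n => by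
    rw [pair_dual, adjoint_inverse_frameOp]
    rfl
  set M := B * ‖K‖ + 1 with hM
  have hM0 : 0 < M := by positivity
  have hlow : ∀ f : H, ‖f‖ ≤ M * ‖W f‖ := by
    intro f
    set u : Hp G hG 2 := ⟨f, dual_memℓp G hG f le_rfl⟩ with hu
    have hcoeff : Hp.coeffIso u = K f := by
      ext n
      exact (hKn f n).symm
    obtain ⟨h1, -, h3, h4⟩ := hC u
    have hCu : ‖C u‖ ≤ M * ‖f‖ := by
      refine h3.trans ?_
      rw [← Hp.coeffIso.norm_map, hcoeff]
      calc B * ‖K f‖ ≤ B * (‖K‖ * ‖f‖) := by gcongr; exact K.le_opNorm f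
        _ ≤ M * ‖f‖ := by rw [hM]; nlinarith [norm_nonneg f]
    -- `H²` embeds continuously into `H`
    have htoH : ∀ w : Hp G hG 2, Hp.toH w =
        ContinuousLinearMap.adjoint (analysisOp G hG) (Hp.coeffIso w) := fun w => by
      have := hasSum_map_single (by simp) (ContinuousLinearMap.adjoint (analysisOp G hG))
        (Hp.coeffIso w)
      simp only [adjoint_analysisOp_single, one_smul, Hp.coeffIso_apply] at this
      exact (hasSum_dual G hG _).unique this
    have h5 := h4.mapL (ContinuousLinearMap.adjoint (analysisOp G hG) ∘L
      Hp.coeffIso.toContinuousLinearMap)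
    have h6 : HasSum (fun n => C u n • E n) f := by
      have hf : (ContinuousLinearMap.adjoint (analysisOp G hG) ∘L
          Hp.coeffIso.toContinuousLinearMap) u = f := (htoH u).symm
      rw [hf] at h5
      refine h5.congr_fun fun n => ?_
      rw [map_smul, h1, ← hx n, htoH]
      rfl
    have h7 : pair 𝕜 f f = inner 𝕜 (W f) (C u) := by
      refine (hasSum_pair_left h6 f).unique ((lp.hasSum_inner (W f) (C u)).congr_fun fun n => ?_)
      rw [hWn, RCLike.inner_apply, pair, pair, inner_conj_symm]
    have h8 : ‖f‖ * ‖f‖ ≤ M * ‖W f‖ * ‖f‖ := by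
      have h9 : ‖pair 𝕜 f f‖ = ‖f‖ * ‖f‖ := by
        rw [pair, inner_self_eq_norm_sq_to_K, norm_pow, RCLike.norm_ofReal, abs_norm, sq]
      rw [← h9, h7]
      calc _ ≤ ‖W f‖ * ‖C u‖ := norm_inner_le_norm _ _
        _ ≤ ‖W f‖ * (M * ‖f‖) := by gcongr
        _ = _ := by ring
    rcases (norm_nonneg f).eq_or_lt with h0 | h0
    · rw [← h0]; positivity
    · exact le_of_mul_le_mul_right h8 h0
  refine ⟨(M ^ 2)⁻¹, max (M ^ 2)⁻¹ (‖W‖ ^ 2), by positivity, le_max_left _ _, fun f =>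
    ⟨(hWsq f).summable, ?_, ?_⟩⟩
  · rw [(hWsq f).tsum_eq, inv_mul_le_iff₀ (by positivity), ← mul_pow]
    gcongr
    exact hlow f
  · rw [(hWsq f).tsum_eq]
    calc ‖W f‖ ^ 2 ≤ (‖W‖ * ‖f‖) ^ 2 := by gcongr; exact W.le_opNorm f
      _ = ‖W‖ ^ 2 * ‖f‖ ^ 2 := mul_pow _ _ _
      _ ≤ _ := by gcongr; exact le_max_right _ _

end Final

end FrameLoc

theorem mainTheorem1 {𝕜 H : Type*} [RCLike 𝕜] [NormedAddCommGroup H] [InnerProductSpace 𝕜 H]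
    [CompleteSpace H] (s : ℝ) (hs : 0 < s)
    (G F : ℤ → H) (hG : FrameLoc.IsFrame 𝕜 G)
    (hGG : FrameLoc.Localized 𝕜 s G G)
    (hFF : FrameLoc.Localized 𝕜 s F F)
    (hFG : FrameLoc.Localized 𝕜 s F G) :
    (∀ (p : ℝ≥0∞) [Fact (1 ≤ p)], ∃ A B : ℝ, FrameLoc.IsHpFrame G hG p F A B) ∧
    ∀ (A B : ℝ≥0∞ → ℝ) (Bsup : ℝ),
      (∀ (p : ℝ≥0∞) [Fact (1 ≤ p)], FrameLoc.IsHpFrame G hG p F (A p) (B p)) →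
      IsLUB (B '' Set.Icc 1 ∞) Bsup →
      ∀ (E : ℤ → H) (ε : ℝ), 0 < ε → ε < Bsup⁻¹ →
        FrameLoc.schurNorm 0 (FrameLoc.gram 𝕜 (E - F) (FrameLoc.dual G hG)) ≤ ENNReal.ofReal ε →
        FrameLoc.Localized 𝕜 0 E E ∧ FrameLoc.Localized 𝕜 0 E F ∧ FrameLoc.Localized 𝕜 0 E G ∧
        ∀ (p : ℝ≥0∞) [Fact (1 ≤ p)],
          FrameLoc.IsHpFrame G hG p E (A p * (1 + ε * B p)⁻¹) (B p * (1 - ε * B p)⁻¹) := by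
  open FrameLoc in
  obtain ⟨-, -, hGGs⟩ := hGG
  obtain ⟨hF, -, hFFs⟩ := hFF
  obtain ⟨-, -, hFGs⟩ := hFG
  have hGd := schurNorm_gram_dual_lt_top G hG hs hGGs
  have hFd := schurNorm_gram_dual_lt_top F hF hs hFFs
  have hGG0 := (schurNorm_mono_exponent hs.le _).trans_lt hGGs
  have hFG0 := (schurNorm_mono_exponent hs.le _).trans_lt hFGs
  have hGF0 := (schurNorm_gram_swap 0 G F).trans_lt hFG0
  have hFGd := schurNorm_gram_dual_right hG hFG0 hGd
  have hGFd := schurNorm_gram_dual_right hF hGF0 hFd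
  refine ⟨fun p _ => exists_isHpFrame p hF hGG0 hGd hFGd hGFd, ?_⟩
  intro A B Bsup hAB hlub E ε hε hεB hle
  have hEGd : schurNorm 0 (gram 𝕜 E (dual G hG)) < ∞ := by
    have : gram 𝕜 E (dual G hG) = gram 𝕜 (E - F) (dual G hG) + gram 𝕜 F (dual G hG) := by
      ext n y
      simp [gram, pair, inner_sub_right]
    rw [this]
    exact (schurNorm_add_le _ _ _).trans_lt
      (ENNReal.add_lt_top.2 ⟨hle.trans_lt ENNReal.ofReal_lt_top, hFGd⟩)
  have hE : ∀ (p : ℝ≥0∞) [Fact (1 ≤ p)],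
      IsHpFrame G hG p E (A p * (1 + ε * B p)⁻¹) (B p * (1 - ε * B p)⁻¹) := fun p hp => by
    have hBsup : 0 < Bsup := inv_pos.1 (hε.trans hεB)
    have hBp : B p ≤ Bsup := hlub.1 ⟨p, ⟨hp.out, le_top⟩, rfl⟩
    refine (hAB p).perturb hGG0 hGd hEGd hε.le ?_ hle
    calc ε * B p ≤ ε * Bsup := by gcongr
      _ < Bsup⁻¹ * Bsup := by gcongr
      _ = 1 := inv_mul_cancel₀ hBsup.ne'
  have hEf : IsFrame 𝕜 E := isFrame_of_isHpFrame_two hEGd (hE 2)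
  have hEG : schurNorm 0 (gram 𝕜 E G) < ∞ := schurNorm_gram_of_dual hG hEGd hGG0
  exact ⟨⟨hEf, hEf, schurNorm_gram_of_dual hG hEGd ((schurNorm_gram_swap 0 G E).trans_lt hEG)⟩,
    ⟨hEf, hF, schurNorm_gram_of_dual hG hEGd hGF0⟩, ⟨hEf, hG, hEG⟩, fun p _ => hE p⟩
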